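/- All graphs are finite and simple. Let $a\ge 0$ and $b\ge 1$ be integers. A graph $G$ is $(a,b)$-choosable if for every assignment of a set $L(v)$ of $a$ integers to each vertex $v$ there are sets $S(v)\subseteq L(v)$ with $|S(v)|=b$ such that $S(u)\cap S(v)=\emptyset$ whenever $u$ and $v$ are adjacent. $G$ is $(a,b)$-paintable if Painter has a winning strategy in the following game: initially each vertex has $a$ tokens and no colours; in each round Lister selects a nonempty set $U$ of vertices that still have tokens and removes one token from each vertex of $U$, and Painter chooses an independent set $I\subseteq U$ and gives each vertex of $I$ one new colour; Lister wins as soon as some vertex has no tokens left and fewer than $b$ colours, and Painter wins as soon as every vertex has at least $b$ colours. For a real number $r$, $G$ is strongly fractional $r$-choosable (respectively, $r$-paintable) if $G$ is $(a,b)$-choosable (respectively, $(a,b)$-paintable) for all such $a,b$ with $a/b\ge r$. The strong fractional choice number $ch^s_f(G)$ (respectively, the strong fractional paint number $\chi^s_{f,P}(G)$) is the infimum of all real $r$ such that $G$ is strongly fractional $r$-choosable (respectively, $r$-paintable). Corollary. There is a function $\varepsilon:\mathbb N\to\mathbb R$ with $\varepsilon(n)\to 0$ as $n\to\infty$ such that,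 for all sufficiently large $n$, every bipartite graph $G$ on $n$ vertices satisfies $$ch^s_f(G)\le \log_2 n-\Bigl(\tfrac12-\varepsilon(n)\Bigr)\log_2\log_2 n .$$ Moreover, $\chi^s_{f,P}(K_{n,n})-ch^s_f(K_{n,n})\to\infty$ as $n\to\infty$. -/

import Mathlib

open Filter Topology

/-- `G` is `(a, b)`-choosable: for every assignment `L` of `a` permissible colours (integers) to each
vertex there is a `b`-fold colouring `S` with `S v ⊆ L v`, adjacent vertices getting disjoint sets. -/
def IsChoosable {V : Type*} (G : SimpleGraph V) (a b : ℕ) : Prop :=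
  ∀ L : V → Finset ℤ, (∀ v, (L v).card = a) →
    ∃ S : V → Finset ℤ, (∀ v, (S v).card = b) ∧ (∀ v, S v ⊆ L v) ∧
      ∀ u v, G.Adj u v → Disjoint (S u) (S v)

/-- `PainterWins G f g`: Painter has a winning strategy in the painting game on `G` from the position
in which vertex `v` has `f v` tokens left and still needs `g v` colours.

* `done`: every vertex has all the colours it needs, so Painter has won.
* `round`: Lister has not won (no vertex is without tokens while still needing colours), and Painter
  has a rule `R` for the coming round: for every nonempty set `U` of vertices that have tokens, chosen
  by Lister, who removes one token from each vertex of `U`, Painter answers with the independent set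
  `R U ⊆ U`, each vertex of which receives one new colour, and Painter has a winning strategy from the
  resulting position.

Every round uses up a token, so on a finite graph every play is finite. -/
inductive PainterWins {V : Type*} (G : SimpleGraph V) : (V → ℕ) → (V → ℕ) → Prop
  | done (f g : V → ℕ) (h : ∀ v, g v = 0) : PainterWins G f g
  | round (f g : V → ℕ) (hlose : ∀ v, f v = 0 → g v = 0)
      (R : Set V → Set V)
      (hR : ∀ U : Set V, U.Nonempty → (∀ v ∈ U, 0 < f v) → R U ⊆ U ∧ G.IsIndepSet (R U))
      (h : ∀ U : Set V, U.Nonempty → (∀ v ∈ U, 0 < f v) →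
        PainterWins G (fun v => f v - U.indicator 1 v) (fun v => g v - (R U).indicator 1 v)) :
      PainterWins G f g

/-- `G` is `(a, b)`-paintable. -/
def IsPaintable {V : Type*} (G : SimpleGraph V) (a b : ℕ) : Prop :=
  PainterWins G (fun _ => a) (fun _ => b)

/-- `G` is strongly fractional `r`-choosable. -/
def IsStronglyFractionalChoosable {V : Type*} (G : SimpleGraph V) (r : ℝ) : Prop :=
  ∀ a b : ℕ, 0 < b → r ≤ (a : ℝ) / (b : ℝ) → IsChoosable G a b

/-- `G` is strongly fractional `r`-paintable. -/
def IsStronglyFractionalPaintable {V : Type*} (G : SimpleGraph V) (r : ℝ) : Prop :=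
  ∀ a b : ℕ, 0 < b → r ≤ (a : ℝ) / (b : ℝ) → IsPaintable G a b

/-- The strong fractional choice number. For a finite graph with at least one vertex the infimum is
over a nonempty set that is bounded below (see the two facts at the end). -/
noncomputable def strongFractionalChoiceNumber {V : Type*} (G : SimpleGraph V) : ℝ :=
  sInf {r : ℝ | IsStronglyFractionalChoosable G r}

/-- The strong fractional paint number. For a finite graph with at least one vertex the infimum is
over a nonempty set that is bounded below (see the two facts at the end). -/
noncomputable def strongFractionalPaintNumber {V : Type*} (G : SimpleGraph V) : ℝ :=
  sInf {r : ℝ | IsStronglyFractionalPaintable G r}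

theorem painterWins_of_sum_le {V : Type*} [Fintype V] (G : SimpleGraph V) :
    ∀ (N : ℕ) (f g : V → ℕ), ∑ v, f v = N → (∀ v, g v = 0 ∨ ∑ u, g u ≤ f v) →
      PainterWins G f g := by
  intro N
  induction N using Nat.strong_induction_on with
  | _ N ih =>
    intro f g hN hfg
    suffices H : ∀ U : Set V, ∃ I : Set V, U.Nonempty → (∀ v ∈ U, 0 < f v) →
        (I ⊆ U ∧ G.IsIndepSet I) ∧
          PainterWins G (fun v => f v - U.indicator 1 v) (fun v => g v - I.indicator 1 v) by
      choose R hR using H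
      refine PainterWins.round f g ?_ R (fun U h1 h2 => (hR U h1 h2).1)
        (fun U h1 h2 => (hR U h1 h2).2)
      intro v hv
      rcases hfg v with h | h
      · exact h
      · have := Finset.single_le_sum (f := g) (fun i _ => Nat.zero_le _) (Finset.mem_univ v)
        omega
    · intro U
      by_cases hUU : U.Nonempty ∧ ∀ v ∈ U, 0 < f v
      swap
      · exact ⟨∅, fun h1 h2 => absurd ⟨h1, h2⟩ hUU⟩
      obtain ⟨hU, hUf⟩ := hUU
      have hlt : ∑ v, (f v - U.indicator 1 v) < N := by
        rw [← hN]
        obtain ⟨u, hu⟩ := hU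
        refine Finset.sum_lt_sum (fun i _ => Nat.sub_le _ _) ⟨u, Finset.mem_univ u, ?_⟩
        have := hUf u hu
        simp [hu]
        omega
      have hind : ∀ w : V, U.indicator (1 : V → ℕ) w ≤ 1 := by
        intro w
        by_cases hw : w ∈ U <;> simp [hw]
      by_cases hex : ∃ v ∈ U, 0 < g v
      · obtain ⟨v, hvU, hv⟩ := hex
        refine ⟨{v}, fun _ _ => ⟨⟨by simpa using hvU, by simp [SimpleGraph.IsIndepSet]⟩,
          ih _ hlt _ _ rfl ?_⟩⟩
        have hs : ∑ u, (g u - ({v} : Set V).indicator 1 u) < ∑ u, g u :=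
          Finset.sum_lt_sum (fun i _ => Nat.sub_le _ _)
            ⟨v, Finset.mem_univ v, by simp; omega⟩
        intro w
        rcases hfg w with h | h
        · left; omega
        · right
          have := hind w
          omega
      · push Not at hex
        refine ⟨∅, fun _ _ => ⟨⟨Set.empty_subset _, by simp [SimpleGraph.IsIndepSet]⟩,
          ih _ hlt _ _ rfl ?_⟩⟩
        intro w
        by_cases hw : w ∈ U
        · left
          have := hex w hw
          omega
        · simpa [hw] using hfg w

theorem PainterWins.le {V : Type*} {G : SimpleGraph V} {f g : V → ℕ}
    (h : PainterWins G f g) (v : V) : g v ≤ f v := by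
  induction h with
  | done f g h => simp [h v]
  | round f g hlose R _ _ ih =>
    rcases Nat.eq_zero_or_pos (f v) with h0 | h0
    · simp [hlose v h0]
    · have hle := ih {v} (Set.singleton_nonempty v) (by simpa using h0)
      have hi : (R {v}).indicator (1 : V → ℕ) v ≤ 1 := by
        by_cases hw : v ∈ R {v} <;> simp [hw]
      simp at hle
      omega

theorem isChoosable_of_card_mul_le {V : Type*} [Fintype V] (G : SimpleGraph V) {a b : ℕ}
    (hab : Fintype.card V * b ≤ a) : IsChoosable G a b := by
  classical
  intro L hL
  have key : ∀ s : Finset V, ∃ S : V → Finset ℤ, ∀ v ∈ s, (S v).card = b ∧ S v ⊆ L v ∧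
      ∀ u ∈ s, u ≠ v → Disjoint (S u) (S v) := by
    intro s
    induction s using Finset.induction_on with
    | empty => exact ⟨fun _ => ∅, by simp⟩
    | insert w s hw ih =>
      obtain ⟨S, hS⟩ := ih
      have h1 : (s.biUnion S).card ≤ s.card * b :=
        Finset.card_biUnion_le_card_mul s S b fun v hv => (hS v hv).1.le
      have h2 : s.card + 1 ≤ Fintype.card V := by
        rw [← Finset.card_insert_of_notMem hw]
        exact Finset.card_le_univ _
      have h3 : b ≤ (L w \ s.biUnion S).card := by
        have := Finset.le_card_sdiff (s.biUnion S) (L w)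
        have h4 := Nat.mul_le_mul_right b h2
        rw [hL w] at this
        rw [Nat.add_mul, Nat.one_mul] at h4
        omega
      obtain ⟨T, hT, hTc⟩ := Finset.exists_subset_card_eq h3
      have hd : ∀ u ∈ s, Disjoint (S u) T := by
        intro u hu
        rw [Finset.disjoint_left]
        intro x hx hxT
        exact (Finset.mem_sdiff.1 (hT hxT)).2 (Finset.mem_biUnion.2 ⟨u, hu, hx⟩)
      refine ⟨Function.update S w T, ?_⟩
      intro v hv
      rcases Finset.mem_insert.1 hv with rfl | hvs
      · refine ⟨by simp [hTc], by simpa using hT.trans Finset.sdiff_subset, ?_⟩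
        intro u hu huv
        have hu' : u ∈ s := (Finset.mem_insert.1 hu).resolve_left huv
        simpa [Function.update_of_ne huv] using hd u hu'
      · have hvw : v ≠ w := fun h => hw (h ▸ hvs)
        simp only [Function.update_of_ne hvw]
        refine ⟨(hS v hvs).1, (hS v hvs).2.1, ?_⟩
        intro u hu huv
        by_cases huw : u = w
        · subst huw
          simpa using (hd v hvs).symm
        · rw [Function.update_of_ne huw]
          exact (hS v hvs).2.2 u ((Finset.mem_insert.1 hu).resolve_left huw) huv
  obtain ⟨S, hS⟩ := key Finset.univ
  exact ⟨S, fun v => (hS v (Finset.mem_univ v)).1, fun v => (hS v (Finset.mem_univ v)).2.1,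
    fun u v huv => (hS v (Finset.mem_univ v)).2.2 u (Finset.mem_univ u) huv.ne⟩

theorem card_mul_le_of_card_le_div {c a b : ℕ} (hb : 0 < b) (h : (c : ℝ) ≤ (a : ℝ) / (b : ℝ)) :
    c * b ≤ a := by
  rw [le_div_iff₀ (by exact_mod_cast hb)] at h
  exact_mod_cast h

/-- If every pair `(a, b)` with `a < b` is excluded, a property of pairs that holds whenever
`r ≤ a / b` forces `0 ≤ r`. -/
theorem nonneg_of_forall_pairs {P : ℕ → ℕ → Prop} (hP : ∀ a b, a < b → ¬ P a b) {r : ℝ}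
    (h : ∀ a b : ℕ, 0 < b → r ≤ (a : ℝ) / (b : ℝ) → P a b) : 0 ≤ r := by
  by_contra hr
  exact hP 0 1 one_pos (h 0 1 one_pos (by simpa using (not_le.1 hr).le))

/-- The infimum defining the strong fractional choice number is a genuine one. -/
theorem strongFractionalChoiceNumber_isGLB {V : Type*} [Fintype V] [Nonempty V]
    (G : SimpleGraph V) :
    IsGLB {r : ℝ | IsStronglyFractionalChoosable G r} (strongFractionalChoiceNumber G) := by
  refine Real.isGLB_sInf ⟨(Fintype.card V : ℝ), ?_⟩ ⟨0, ?_⟩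
  · intro a b hb hab
    exact isChoosable_of_card_mul_le G (card_mul_le_of_card_le_div hb hab)
  · intro r hr
    refine nonneg_of_forall_pairs (P := IsChoosable G) ?_ hr
    intro a b hab h
    obtain ⟨S, h1, h2, _⟩ := h (fun _ => (Finset.range a).map Nat.castEmbedding) (by simp)
    have v := Classical.arbitrary V
    have h3 := Finset.card_le_card (h2 v)
    rw [h1 v, Finset.card_map, Finset.card_range] at h3
    omega

/-- The infimum defining the strong fractional paint number is a genuine one. -/
theorem strongFractionalPaintNumber_isGLB {V : Type*} [Fintype V] [Nonempty V]
    (G : SimpleGraph V) :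
    IsGLB {r : ℝ | IsStronglyFractionalPaintable G r} (strongFractionalPaintNumber G) := by
  refine Real.isGLB_sInf ⟨(Fintype.card V : ℝ), ?_⟩ ⟨0, ?_⟩
  · intro a b hb hab
    refine painterWins_of_sum_le G _ (fun _ => a) (fun _ => b) rfl fun v => Or.inr ?_
    simpa using card_mul_le_of_card_le_div hb hab
  · intro r hr
    refine nonneg_of_forall_pairs (P := IsPaintable G) ?_ hr
    intro a b hab h
    have := PainterWins.le h (Classical.arbitrary V)
    omega

/-! In a bipartite graph it suffices to reserve a set `P` of colours for one side and to leave the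
other colours to the other side. For `b ≥ 2` a uniformly random `P` already works when `a / b` is
slightly above `(5 / 8) log₂ n` (`isChoosable_of_two_le`), so only `b = 1` is critical. There the
colours are ordered at random and `P` consists of the last colours of the lists on one side. This
fails only if the last colour of such a list is the first colour of a list on the other side
(`exists_order_no_conflict`). The union bound allows lists of size `log₂ n - (1/2) log₂ log₂ n +
√(log₂ log₂ n)`, whence `ε = 1 / √(log₂ log₂ n)`.

For the gap, Lister beats Painter on `K_{n,n}` with `k` tokens and one colour per vertex when `n` is
about `2 * 2 ^ k * k ^ (1/3)` (`not_isPaintable_completeBipartiteGraph`). So the paint number is at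
least `log₂ n - (1/3) log₂ log₂ n - O(1)`, and `1/3 < 1/2`.

Vertices are chips, on the level given by the number of tokens lost. Painter colours on one side
only, so in each round all chips offered on the other side advance (`ChipProfile.round`), and none
may reach level `k`. Lister always offers the same fraction `1 / (q + 1)` of each level. Up to
rounding, the position then depends only on how often each side has advanced (`levelDensity`,
`evolve_ge`). After `t` rounds shared equally, the density on level `i` is about `2 ^ (-i)` times a
Poisson weight with mean `t / q`, which is of order `1 / √i` near `t = i q`. A lead of `q D` rounds
multiplies a side's density by a factor exponential in `D`, whereas a moderate imbalance costs the
product of the two densities only a constant factor (`levelDensity_mul_ge`).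

A single run would lose the factor `√k`. Instead half of the chips are aimed at level `k` and force
Painter to stay balanced during a window of about `q √m` rounds, while the other half accumulate on
level `m = k - c`; the length of the window makes up for the Poisson factor `1 / √m`
(`ChipProfile.exists_collected`). The collected chips start a new game with only `c` tokens, where
all losses are polynomial in `c`, a small power of `k` (`ChipProfile.false_of_large`). -/

/-! ### Splitting the colours between the two sides -/

theorem isChoosable_of_split {V : Type*} {G : SimpleGraph V} {a b : ℕ} (C : G.Coloring (Fin 2))
    (h : ∀ L : V → Finset ℤ, (∀ v, (L v).card = a) → ∃ P : Finset ℤ,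
      (∀ v, C v = 0 → b ≤ (L v ∩ P).card) ∧ ∀ v, C v ≠ 0 → b ≤ (L v \ P).card) :
    IsChoosable G a b := by
  intro L hL
  obtain ⟨P, h0, h1⟩ := h L hL
  have key : ∀ v, ∃ S : Finset ℤ, S.card = b ∧ S ⊆ L v ∧ (C v = 0 → S ⊆ P) ∧
      (C v ≠ 0 → Disjoint S P) := by
    intro v
    by_cases hv : C v = 0
    · obtain ⟨S, hS, hc⟩ := Finset.exists_subset_card_eq (h0 v hv)
      exact ⟨S, hc, hS.trans Finset.inter_subset_left, fun _ => hS.trans Finset.inter_subset_right,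
        fun h => absurd hv h⟩
    · obtain ⟨S, hS, hc⟩ := Finset.exists_subset_card_eq (h1 v hv)
      exact ⟨S, hc, hS.trans Finset.sdiff_subset, fun h => absurd h hv,
        fun _ => Finset.disjoint_of_subset_left hS Finset.sdiff_disjoint⟩
  choose S hS using key
  refine ⟨S, fun v => (hS v).1, fun v => (hS v).2.1, fun u v huv => ?_⟩
  have hne := C.valid huv
  by_cases hu : C u = 0
  · have hv : C v ≠ 0 := fun h => hne (hu.trans h.symm)
    exact (Finset.disjoint_of_subset_right ((hS u).2.2.1 hu) ((hS v).2.2.2 hv)).symm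
  · have hv : C v = 0 := by
      generalize C u = p at *
      generalize C v = q at *
      fin_cases p <;> fin_cases q <;> simp_all
    exact Finset.disjoint_of_subset_right ((hS v).2.2.1 hv) ((hS u).2.2.2 hu)

theorem sum_powerset_pow_card_inter {α : Type*} [DecidableEq α] {C E : Finset α} (hE : E ⊆ C)
    (z : ℝ) :
    ∑ P ∈ C.powerset, z ^ (E ∩ P).card = 2 ^ C.card * ((1 + z) / 2) ^ E.card := by
  have h := Finset.prod_one_add (f := fun i => if i ∈ E then z else 1) C
  have h1 : ∀ P ∈ C.powerset, ∏ i ∈ P, (if i ∈ E then z else 1) = z ^ (E ∩ P).card := by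
    intro P _
    rw [Finset.prod_ite, Finset.prod_const, Finset.prod_const_one, mul_one, Finset.filter_mem_eq_inter,
      Finset.inter_comm]
  rw [Finset.sum_congr rfl h1] at h
  rw [← h]
  have h2 : ∏ i ∈ C, (1 + if i ∈ E then z else 1) = (1 + z) ^ E.card * 2 ^ (C \ E).card := by
    rw [← Finset.prod_sdiff hE, mul_comm]
    congr 1
    · rw [← Finset.prod_const]
      exact Finset.prod_congr rfl fun i hi => by simp [hi]
    · rw [← Finset.prod_const]
      refine Finset.prod_congr rfl fun i hi => ?_
      rw [if_neg (Finset.mem_sdiff.1 hi).2]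
      norm_num
  rw [h2, Finset.card_sdiff_of_subset hE, div_pow, pow_sub₀ _ two_ne_zero (Finset.card_le_card hE)]
  field_simp

theorem sum_powerset_pow_card_sdiff {α : Type*} [DecidableEq α] {C E : Finset α} (hE : E ⊆ C)
    (z : ℝ) :
    ∑ P ∈ C.powerset, z ^ (E \ P).card = 2 ^ C.card * ((1 + z) / 2) ^ E.card := by
  rw [← sum_powerset_pow_card_inter hE]
  refine Finset.sum_bij' (fun P _ => C \ P) (fun P _ => C \ P) ?_ ?_ ?_ ?_ ?_
  · intro P _; simp
  · intro P _; simp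
  · intro P hP
    exact Finset.sdiff_sdiff_eq_self (Finset.mem_powerset.1 hP)
  · intro P hP
    exact Finset.sdiff_sdiff_eq_self (Finset.mem_powerset.1 hP)
  · intro P hP
    congr 2
    ext c
    simp only [Finset.mem_sdiff, Finset.mem_inter]
    exact ⟨fun h => ⟨h.1, hE h.1, h.2⟩, fun h => ⟨h.1, h.2.2⟩⟩

/-- A uniformly random splitting of the colours works for `b`-fold colourings when `b` is not too
small compared with `a`. -/
theorem isChoosable_of_exponential_moment {V : Type*} [Fintype V] {G : SimpleGraph V} {a b : ℕ}
    (hG : G.IsBipartite)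
    (h : (Fintype.card V : ℝ) * (8 ^ b * (9 / 16) ^ a) < 1) : IsChoosable G a b := by
  classical
  obtain ⟨C⟩ := hG
  refine isChoosable_of_split C fun L hL => ?_
  set K : Finset ℤ := Finset.univ.biUnion L with hK
  have hLK : ∀ v, L v ⊆ K := fun v => Finset.subset_biUnion_of_mem L (Finset.mem_univ v)
  by_contra hcon
  push Not at hcon
  -- Exponential Markov bound: a vertex with fewer than `b` usable colours has a term at least one,
  -- and the average of one term over all `P` is `8 ^ b * (9 / 16) ^ a`.
  have key : ∀ P ∈ K.powerset, (1 : ℝ) ≤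
      ∑ v, 8 ^ b * (1 / 8 : ℝ) ^ (if C v = 0 then (L v ∩ P).card else (L v \ P).card) := by
    intro P _
    have : ∃ v, (if C v = 0 then (L v ∩ P).card else (L v \ P).card) < b := by
      by_cases hP : ∀ v, C v = 0 → b ≤ (L v ∩ P).card
      · obtain ⟨v, hv, hlt⟩ := hcon P hP
        exact ⟨v, by simpa [hv] using hlt⟩
      · push Not at hP
        obtain ⟨v, hv, hlt⟩ := hP
        exact ⟨v, by simpa [hv] using hlt⟩
    obtain ⟨v, hv⟩ := this
    refine le_trans ?_ (Finset.single_le_sum (f := fun v => 8 ^ b * (1 / 8 : ℝ) ^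
      (if C v = 0 then (L v ∩ P).card else (L v \ P).card)) (fun i _ => by positivity)
      (Finset.mem_univ v))
    calc (1 : ℝ) = 8 ^ b * (1 / 8) ^ b := by rw [← mul_pow]; norm_num
      _ ≤ _ := by
        gcongr 8 ^ b * ?_
        exact pow_le_pow_of_le_one (by norm_num) (by norm_num) hv.le
  have h1 := Finset.sum_le_sum key
  rw [Finset.sum_comm] at h1
  have h2 : ∀ v ∈ Finset.univ, ∑ P ∈ K.powerset,
      8 ^ b * (1 / 8 : ℝ) ^ (if C v = 0 then (L v ∩ P).card else (L v \ P).card) =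
        8 ^ b * (2 ^ K.card * (9 / 16) ^ a) := by
    intro v _
    rw [← Finset.mul_sum]
    congr 1
    by_cases hv : C v = 0
    · simp only [hv, if_true]
      rw [sum_powerset_pow_card_inter (hLK v), hL v]
      norm_num
    · simp only [hv, if_false]
      rw [sum_powerset_pow_card_sdiff (hLK v), hL v]
      norm_num
  rw [Finset.sum_congr rfl h2] at h1
  simp only [Finset.sum_const, Finset.card_powerset, nsmul_eq_mul, mul_one, Finset.card_univ] at h1
  push_cast at h1
  have h3 : (0 : ℝ) < 2 ^ K.card := by positivity
  nlinarith

/-! ### Random orders of the colours -/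

theorem card_piFinset_eq_mul_prod_div {α : Type*} [Fintype α] [DecidableEq α] {N : ℕ} (hN : 0 < N)
    (e : Finset α) (S : α → Finset (Fin N)) (hS : ∀ c ∉ e, S c = Finset.univ) :
    ((Fintype.piFinset S).card : ℝ) =
      (N : ℝ) ^ Fintype.card α * ∏ c ∈ e, ((S c).card / N : ℝ) := by
  have hN' : (N : ℝ) ≠ 0 := by positivity
  have h1 : ∏ c ∈ e, ((S c).card / N : ℝ) = ∏ c, ((S c).card / N : ℝ) := by
    refine Finset.prod_subset (Finset.subset_univ _) fun c _ hc => ?_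
    rw [hS c hc, Finset.card_univ, Fintype.card_fin, div_self hN']
  rw [h1, Finset.prod_div_distrib, Finset.prod_const, Finset.card_univ, Fintype.card_piFinset]
  push_cast
  field_simp

theorem card_piFinset_forall_mem {α : Type*} [Fintype α] [DecidableEq α] {N k : ℕ} (hN : 0 < N)
    (e : Finset α) (he : e.card = k) (T : Finset (Fin N)) :
    ((Fintype.piFinset fun c => if c ∈ e then T else Finset.univ).card : ℝ) =
      (N : ℝ) ^ Fintype.card α * ((T.card : ℝ) / N) ^ k := by
  rw [card_piFinset_eq_mul_prod_div hN e _ (by intro c hc; simp [hc])]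
  congr 1
  rw [Finset.prod_congr rfl (g := fun _ => ((T.card : ℝ) / N)) (by intro c hc; simp [hc]),
    Finset.prod_const, he]

/-- The sets share only `v`, so the constraints on their other elements are independent, with
probabilities `(j + 1) / N` and `(N - j) / N`. -/
theorem card_piFinset_conflict_le {α : Type*} [Fintype α] [DecidableEq α] {N k : ℕ} (hN : 0 < N)
    (e f : Finset α) (he : e.card = k) (hf : f.card = k) (v : α) (hv : e ∩ f = {v}) (j : Fin N) :
    ((Fintype.piFinset fun c => if c = v then {j} else if c ∈ e then Finset.Iic j
      else if c ∈ f then Finset.Ici j else Finset.univ).card : ℝ) ≤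
      (N : ℝ) ^ Fintype.card α * (1 / N * (((N + 1 : ℝ) / (2 * N)) ^ 2) ^ (k - 1)) := by
  have hve : v ∈ e ∧ v ∈ f := by
    rw [← Finset.mem_inter, hv]; simp
  have hN' : (0 : ℝ) < N := by exact_mod_cast hN
  rw [card_piFinset_eq_mul_prod_div hN (e ∪ f) _ (by
    intro c hc
    rw [Finset.mem_union, not_or] at hc
    have : c ≠ v := by rintro rfl; exact hc.1 hve.1
    simp [this, hc.1, hc.2])]
  refine mul_le_mul_of_nonneg_left ?_ (by positivity)
  have hd : Disjoint (e.erase v) (f.erase v) := by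
    rw [Finset.disjoint_left]
    intro c hc hc'
    rw [Finset.mem_erase] at hc hc'
    have : c ∈ e ∩ f := Finset.mem_inter.2 ⟨hc.2, hc'.2⟩
    rw [hv, Finset.mem_singleton] at this
    exact hc.1 this
  have hu : e ∪ f = insert v ((e.erase v) ∪ (f.erase v)) := by
    ext c
    simp only [Finset.mem_union, Finset.mem_insert, Finset.mem_erase]
    by_cases hc : c = v
    · simp [hc, hve.1]
    · simp [hc]
  rw [hu, Finset.prod_insert (by simp), Finset.prod_union hd]
  have h1 : ∀ c ∈ e.erase v, (((if c = v then {j} else if c ∈ e then Finset.Iic j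
      else if c ∈ f then Finset.Ici j else Finset.univ : Finset (Fin N)).card : ℝ) / N) =
      ((j : ℝ) + 1) / N := by
    intro c hc
    rw [Finset.mem_erase] at hc
    simp [hc.1, hc.2]
  have h2 : ∀ c ∈ f.erase v, (((if c = v then {j} else if c ∈ e then Finset.Iic j
      else if c ∈ f then Finset.Ici j else Finset.univ : Finset (Fin N)).card : ℝ) / N) =
      ((N : ℝ) - j) / N := by
    intro c hc
    have hce : c ∉ e := fun h =>
      (Finset.disjoint_left.1 hd (Finset.mem_erase.2 ⟨(Finset.mem_erase.1 hc).1, h⟩) hc)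
    rw [Finset.mem_erase] at hc
    simp [hc.1, hc.2, hce, Nat.cast_sub j.2.le]
  rw [Finset.prod_congr rfl h1, Finset.prod_congr rfl h2, Finset.prod_const, Finset.prod_const,
    Finset.card_erase_of_mem hve.1, Finset.card_erase_of_mem hve.2, he, hf]
  simp only [if_true, Finset.card_singleton, Nat.cast_one]
  refine mul_le_mul_of_nonneg_left ?_ (by positivity)
  rw [← mul_pow]
  have hj : (j : ℝ) ≤ N := by exact_mod_cast j.2.le
  refine pow_le_pow_left₀ (mul_nonneg (by positivity) (div_nonneg (by linarith) hN'.le)) ?_ _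
  rw [div_mul_div_comm, div_pow, div_le_div_iff₀ (by positivity) (by positivity)]
  -- AM-GM: the two factors sum to `N + 1` for every `j`.
  have h3 : ((j : ℝ) + 1) * (N - j) * 4 ≤ (N + 1) ^ 2 := by
    nlinarith [sq_nonneg ((j : ℝ) + 1 - (N - j))]
  have h4 : (0 : ℝ) < N * N := by positivity
  nlinarith

/-- If the given union bound is below one, the colours can be ordered in such a way that the last
element of a set on one side is never the first element of a set on the other side. -/
theorem exists_order_no_conflict {α V : Type*} [Fintype α] [LinearOrder α] [Fintype V]
    (side : V → Prop) (E : V → Finset α) {k s t : ℕ} (hN : 0 < 2 * s + t)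
    (hE : ∀ v, (E v).card = k)
    (h : (Fintype.card V : ℝ) * ((s : ℝ) / (2 * s + t : ℕ)) ^ k + (Fintype.card V : ℝ) ^ 2 *
      (t * (1 / (2 * s + t : ℕ) *
        ((((2 * s + t : ℕ) + 1 : ℝ) / (2 * (2 * s + t : ℕ))) ^ 2) ^ (k - 1))) < 1) :
    ∃ w : α → Fin (2 * s + t), ∀ x y, side x → ¬ side y → ∀ v ∈ E x, v ∈ E y →
      (∀ c ∈ E x, toLex (w c, c) ≤ toLex (w v, v)) →
      ¬ ∀ c ∈ E y, toLex (w v, v) ≤ toLex (w c, c) := by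
  classical
  set N := 2 * s + t with hNdef
  by_contra hcon
  push Not at hcon
  -- If the conflict element has low weight, all of `E x` is low; if it has high weight, all of `E
  -- y` is high. Only the middle band needs a union bound over pairs.
  let low : Finset (Fin N) := Finset.univ.filter fun i => i.1 < s
  let high : Finset (Fin N) := Finset.univ.filter fun i => s + t ≤ i.1
  let mid : Finset (Fin N) := Finset.univ.filter fun i => s ≤ i.1 ∧ i.1 < s + t
  have hlow : low.card ≤ s := by
    have : low.card ≤ (Finset.range s).card := by
      refine Finset.card_le_card_of_injOn Fin.val ?_ Fin.val_injective.injOn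
      intro i hi
      simpa [low] using hi
    simpa using this
  have hhigh : high.card ≤ s := by
    have : high.card ≤ (Finset.Ico (s + t) (2 * s + t)).card := by
      refine Finset.card_le_card_of_injOn Fin.val ?_ Fin.val_injective.injOn
      intro i hi
      have := i.2
      simp [high] at hi ⊢
      omega
    simp at this
    omega
  have hmid : mid.card ≤ t := by
    have : mid.card ≤ (Finset.Ico s (s + t)).card := by
      refine Finset.card_le_card_of_injOn Fin.val ?_ Fin.val_injective.injOn
      intro i hi
      simpa [mid] using hi
    simpa using this
  let A : V → Finset (α → Fin N) := fun v =>
    Fintype.piFinset fun c => if c ∈ E v then (if side v then low else high) else Finset.univ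
  let B : V → V → Finset (α → Fin N) := fun x y =>
    if hxy : ∃ v, E x ∩ E y = {v} then
      mid.biUnion fun j => Fintype.piFinset fun c => if c = hxy.choose then {j} else
        if c ∈ E x then Finset.Iic j else if c ∈ E y then Finset.Ici j else Finset.univ
    else ∅
  have hcover : (Finset.univ : Finset (α → Fin N)) ⊆
      Finset.univ.biUnion A ∪ Finset.univ.biUnion fun p : V × V => B p.1 p.2 := by
    intro w _
    obtain ⟨x, y, hx, hy, v, hvx, hvy, h1, h2⟩ := hcon w
    have h1' : ∀ c ∈ E x, w c ≤ w v := fun c hc => by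
      rcases Prod.Lex.le_iff.1 (h1 c hc) with h | h
      · exact le_of_lt h
      · exact le_of_eq h.1
    have h2' : ∀ c ∈ E y, w v ≤ w c := fun c hc => by
      rcases Prod.Lex.le_iff.1 (h2 c hc) with h | h
      · exact le_of_lt h
      · exact le_of_eq h.1
    rw [Finset.mem_union]
    by_cases hl : (w v).1 < s
    · left
      refine Finset.mem_biUnion.2 ⟨x, Finset.mem_univ _, Fintype.mem_piFinset.2 fun c => ?_⟩
      by_cases hc : c ∈ E x
      · have := h1' c hc
        rw [Fin.le_def] at this
        simp [hc, hx, low]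
        omega
      · simp [hc]
    by_cases hh : s + t ≤ (w v).1
    · left
      refine Finset.mem_biUnion.2 ⟨y, Finset.mem_univ _, Fintype.mem_piFinset.2 fun c => ?_⟩
      by_cases hc : c ∈ E y
      · have := h2' c hc
        rw [Fin.le_def] at this
        simp [hc, hy, high]
        omega
      · simp [hc]
    · right
      refine Finset.mem_biUnion.2 ⟨(x, y), Finset.mem_univ _, ?_⟩
      -- Ties are broken by the colour itself, so a common element lying both below and above `v`
      -- must be `v`.
      have hxy : E x ∩ E y = {v} := by
        ext c
        simp only [Finset.mem_inter, Finset.mem_singleton]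
        constructor
        · rintro ⟨hc1, hc2⟩
          have := le_antisymm (h1 c hc1) (h2 c hc2)
          exact (Prod.ext_iff.1 (toLex.injective this)).2
        · rintro rfl
          exact ⟨hvx, hvy⟩
      have hex : ∃ v, E x ∩ E y = {v} := ⟨v, hxy⟩
      have hch : hex.choose = v :=
        Finset.singleton_injective (hex.choose_spec.symm.trans hxy)
      simp only [B, dif_pos hex, hch]
      refine Finset.mem_biUnion.2 ⟨w v, ?_, Fintype.mem_piFinset.2 fun c => ?_⟩
      · simp [mid]
        omega
      · by_cases hcv : c = v
        · simp [hcv]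
        · by_cases hcx : c ∈ E x
          · simpa [hcv, hcx] using h1' c hcx
          · by_cases hcy : c ∈ E y
            · simpa [hcv, hcx, hcy] using h2' c hcy
            · simp [hcv, hcx, hcy]
  have hN' : (0 : ℝ) < N := by exact_mod_cast hN
  set M : ℝ := (N : ℝ) ^ Fintype.card α with hM
  have hMpos : 0 < M := by positivity
  set ρ : ℝ := 1 / N * (((N + 1 : ℝ) / (2 * N)) ^ 2) ^ (k - 1) with hρ
  have hρ0 : 0 ≤ ρ := by positivity
  have hA : ∀ v, ((A v).card : ℝ) ≤ M * ((s : ℝ) / N) ^ k := by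
    intro v
    have := card_piFinset_forall_mem hN (E v) (hE v) (if side v then low else high)
    simp only [A]
    rw [this]
    have hc : (((if side v then low else high).card : ℕ) : ℝ) ≤ s := by
      split_ifs
      · exact_mod_cast hlow
      · exact_mod_cast hhigh
    gcongr
  have hB : ∀ x y, ((B x y).card : ℝ) ≤ M * (t * ρ) := by
    intro x y
    by_cases hxy : ∃ v, E x ∩ E y = {v}
    · simp only [B, dif_pos hxy]
      refine (Nat.cast_le.2 Finset.card_biUnion_le).trans ?_
      push_cast
      refine (Finset.sum_le_sum fun j _ => card_piFinset_conflict_le hN (E x) (E y) (hE x) (hE y) _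
        hxy.choose_spec j).trans ?_
      rw [Finset.sum_const, nsmul_eq_mul, mul_left_comm]
      have : (mid.card : ℝ) ≤ t := by exact_mod_cast hmid
      gcongr
    · simp only [B, dif_neg hxy]
      simp only [Finset.card_empty, Nat.cast_zero]
      positivity
  have hfin : M ≤ Fintype.card V * (M * ((s : ℝ) / N) ^ k) + (Fintype.card V : ℝ) ^ 2 * (M * (t * ρ)) := by
    have h1 := Finset.card_le_card hcover
    have h2 := (h1.trans (Finset.card_union_le _ _)).trans
      (add_le_add Finset.card_biUnion_le Finset.card_biUnion_le)
    rw [Finset.card_univ, Fintype.card_fun, Fintype.card_fin] at h2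
    have h3 : M ≤ ∑ v, ((A v).card : ℝ) + ∑ p : V × V, ((B p.1 p.2).card : ℝ) := by
      rw [hM]
      exact_mod_cast h2
    refine h3.trans (add_le_add ?_ ?_)
    · refine (Finset.sum_le_sum fun v _ => hA v).trans ?_
      rw [Finset.sum_const, nsmul_eq_mul, Finset.card_univ]
    · refine (Finset.sum_le_sum fun p _ => hB p.1 p.2).trans ?_
      rw [Finset.sum_const, nsmul_eq_mul, Finset.card_univ, Fintype.card_prod]
      push_cast
      rw [sq]
  have : M * 1 ≤ M * (Fintype.card V * ((s : ℝ) / N) ^ k + (Fintype.card V : ℝ) ^ 2 * (t * ρ)) := by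
    rw [mul_one]; refine hfin.trans (le_of_eq ?_); ring
  have := le_of_mul_le_mul_left this hMpos
  linarith

/-- The Radhakrishnan–Srinivasan bound for choosability of bipartite graphs, by the argument of
Cherkashin and Kozik. -/
theorem isChoosable_one_of_union_bound {V : Type*} [Fintype V] {G : SimpleGraph V} {k s t : ℕ}
    (hG : G.IsBipartite) (hk : 0 < k) (hN : 0 < 2 * s + t)
    (h : (Fintype.card V : ℝ) * ((s : ℝ) / (2 * s + t : ℕ)) ^ k + (Fintype.card V : ℝ) ^ 2 *
      (t * (1 / (2 * s + t : ℕ) *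
        ((((2 * s + t : ℕ) + 1 : ℝ) / (2 * (2 * s + t : ℕ))) ^ 2) ^ (k - 1))) < 1) :
    IsChoosable G k 1 := by
  classical
  obtain ⟨C⟩ := hG
  refine isChoosable_of_split C fun L hL => ?_
  set K : Finset ℤ := Finset.univ.biUnion L with hK
  have hLK : ∀ v, L v ⊆ K := fun v => Finset.subset_biUnion_of_mem L (Finset.mem_univ v)
  have hcard : ∀ v, ((L v).subtype (· ∈ K)).card = k := by
    intro v
    rw [Finset.card_subtype, Finset.filter_true_of_mem fun c hc => hLK v hc, hL v]
  obtain ⟨w, hw⟩ := exists_order_no_conflict (α := K) (fun v => C v = 0)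
    (fun v => (L v).subtype (· ∈ K)) hN hcard h
  let ρ : K → (Fin (2 * s + t) ×ₗ K) := fun c => toLex (w c, c)
  have hmem : ∀ v (c : K), c ∈ (L v).subtype (· ∈ K) ↔ (c : ℤ) ∈ L v := fun v c => by simp
  have hne : ∀ v, ((L v).subtype (· ∈ K)).Nonempty := fun v =>
    Finset.card_pos.1 (by rw [hcard v]; exact hk)
  have hmax := fun v => Finset.exists_max_image _ ρ (hne v)
  have hmin := fun v => Finset.exists_min_image _ ρ (hne v)
  choose mx hmx1 hmx2 using hmax
  choose mn hmn1 hmn2 using hmin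
  -- `P` is the set of last colours on the first side; the first colour of any list on the second
  -- side then lies outside `P`.
  refine ⟨(Finset.univ.filter fun v => C v = 0).image fun v => (mx v : ℤ), ?_, ?_⟩
  · intro v hv
    refine Finset.card_pos.2 ⟨mx v, Finset.mem_inter.2 ⟨(hmem v _).1 (hmx1 v), ?_⟩⟩
    exact Finset.mem_image.2 ⟨v, by simp [hv], rfl⟩
  · intro v hv
    refine Finset.card_pos.2 ⟨mn v, Finset.mem_sdiff.2 ⟨(hmem v _).1 (hmn1 v), ?_⟩⟩
    intro hmem'
    obtain ⟨x, hx, hxe⟩ := Finset.mem_image.1 hmem'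
    have hx0 : C x = 0 := by simpa using hx
    have hxe' : mx x = mn v := Subtype.ext hxe
    refine hw x v hx0 hv (mx x) (hmx1 x) (by rw [hxe']; exact hmn1 v) (hmx2 x) ?_
    rw [hxe']
    exact hmn2 v

/-! ### Asymptotics of the choosability bounds -/

theorem nine_div_sixteen_pow_le (a : ℕ) : (9 / 16 : ℝ) ^ a ≤ (2 : ℝ) ^ (-(4 / 5) * (a : ℝ)) := by
  have h : (9 / 16 : ℝ) ≤ (2 : ℝ) ^ (-(4 / 5) : ℝ) := by
    refine le_of_pow_le_pow_left₀ (n := 5) (by norm_num) (by positivity) ?_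
    rw [← Real.rpow_natCast ((2 : ℝ) ^ (-(4 / 5) : ℝ)), ← Real.rpow_mul (by norm_num)]
    norm_num
  rw [Real.rpow_mul (by norm_num), Real.rpow_natCast]
  exact pow_le_pow_left₀ (by norm_num) h a

/-- The exponent is at most `x + b * (3 - 4 r / 5)`, which decreases in `b` because `r ≥ 5`; hence
`b = 2` is the worst case. -/
theorem isChoosable_of_two_le {V : Type*} [Fintype V] {G : SimpleGraph V} {a b : ℕ} {x r : ℝ}
    (hG : G.IsBipartite) (hx : (Fintype.card V : ℝ) = 2 ^ x) (hb : 2 ≤ b)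
    (h1 : 5 ≤ r) (h2 : x + 6 < 8 / 5 * r) (hr : r * b ≤ a) : IsChoosable G a b := by
  refine isChoosable_of_exponential_moment hG ?_
  have h8 : (8 : ℝ) ^ b = 2 ^ (3 * (b : ℝ)) := by
    rw [Real.rpow_mul (by norm_num), Real.rpow_natCast]
    norm_num
  have hb' : (2 : ℝ) ≤ b := by exact_mod_cast hb
  calc (Fintype.card V : ℝ) * (8 ^ b * (9 / 16) ^ a)
      ≤ 2 ^ x * (2 ^ (3 * (b : ℝ)) * 2 ^ (-(4 / 5) * (a : ℝ))) := by
        rw [hx, h8]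
        gcongr
        exact nine_div_sixteen_pow_le a
    _ = 2 ^ (x + (3 * b + -(4 / 5) * a)) := by
        rw [← Real.rpow_add (by norm_num), ← Real.rpow_add (by norm_num)]
    _ < 1 := by
        refine Real.rpow_lt_one_of_one_lt_of_neg (by norm_num) ?_
        nlinarith

theorem isChoosable_one_of_log_bound {V : Type*} [Fintype V] {G : SimpleGraph V} {a : ℕ} {x y : ℝ}
    (hG : G.IsBipartite) (hx : (Fintype.card V : ℝ) = 2 ^ x) (hxy : x = 2 ^ y) (hy : 2 < y)
    (h1 : 24 * (y + 1) * 4 ^ (-√y) < 1 / 2) (ha : x - y / 2 + √y ≤ a) (h2 : y + 1 ≤ a)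
    (h3 : x ≤ 2 * a) : IsChoosable G a 1 := by
  set q := ⌈y⌉₊ with hq
  have hqy : y ≤ q := Nat.le_ceil y
  have hqy' : (q : ℝ) < y + 1 := Nat.ceil_lt_add_one (by linarith)
  have hqa : q ≤ a := by
    have : (q : ℝ) ≤ a := hqy'.le.trans h2
    exact_mod_cast this
  have ha0 : (0 : ℝ) < a := by linarith
  have ha1 : 0 < a := by exact_mod_cast ha0
  have hs : 2 * (a - q) + 2 * q = 2 * a := by omega
  -- With `2 a` weights and a middle band of width about `2 y`, one-sided events gain `exp (-q) ≤ 2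
  -- ^ (-y)`, while the band costs pairs only a factor `q / a`. The latter cancels `4 ^ (y / 2) = x`
  -- up to a factor of order `y`, which `4 ^ (-√y)` absorbs.
  refine isChoosable_one_of_union_bound (s := a - q) (t := 2 * q) hG ha1 (by omega) ?_
  rw [hs, hx, Nat.cast_sub hqa]
  push_cast
  have hsy := Real.sqrt_nonneg y
  have hxa : x - a ≤ y / 2 - √y := by linarith
  have e1 : (((a : ℝ) - q) / (2 * a)) ^ a ≤ 2 ^ (-(a : ℝ)) * 2 ^ (-y) := by
    have : ((a : ℝ) - q) / (2 * a) = 2⁻¹ * (1 - q / a) := by field_simp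
    rw [this, mul_pow, Real.rpow_neg (by norm_num), Real.rpow_natCast, inv_pow]
    gcongr
    refine (Real.one_sub_div_pow_le_exp_neg (by exact_mod_cast hqa)).trans ?_
    rw [Real.rpow_def_of_pos (by norm_num)]
    have := Real.log_two_lt_d9
    have := Real.log_two_gt_d9
    refine Real.exp_le_exp.2 ?_
    nlinarith
  -- The constant is `12 = 3 * 4`: the correction `(1 + 1 / (2 a)) ^ (2 (a - 1))` is at most `e <
  -- 3`, and the exponent `a - 1` in place of `a` costs `4`.
  have e2 : (((2 * (a : ℝ) + 1) / (2 * (2 * a))) ^ 2) ^ (a - 1) ≤ 12 * 4 ^ (-(a : ℝ)) := by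
    obtain ⟨c, rfl⟩ : ∃ c, a = c + 1 := ⟨a - 1, by omega⟩
    have : ((2 * ((c + 1 : ℕ) : ℝ) + 1) / (2 * (2 * (c + 1 : ℕ)))) ^ 2 =
        4⁻¹ * (1 + 1 / (2 * ((c + 1 : ℕ) : ℝ))) ^ 2 := by
      field_simp
      norm_num
    rw [this, mul_pow, Nat.add_sub_cancel, ← pow_mul]
    have h3 : (1 + 1 / (2 * ((c + 1 : ℕ) : ℝ))) ^ (2 * c) ≤ 3 := by
      have h4 : (1 + 1 / (2 * ((c + 1 : ℕ) : ℝ))) ≤ Real.exp (1 / (2 * ((c + 1 : ℕ) : ℝ))) := by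
        rw [add_comm]
        exact Real.add_one_le_exp _
      refine (pow_le_pow_left₀ (by positivity) h4 _).trans ?_
      rw [← Real.exp_nat_mul]
      have h5 : ((2 * c : ℕ) : ℝ) * (1 / (2 * ((c + 1 : ℕ) : ℝ))) ≤ 1 := by
        push_cast
        rw [mul_one_div, div_le_one (by positivity)]
        linarith
      refine (Real.exp_le_exp.2 h5).trans ?_
      have := Real.exp_one_lt_d9
      linarith
    have h6 : (4 : ℝ) ^ (-((c + 1 : ℕ) : ℝ)) = 4⁻¹ ^ c * 4⁻¹ := by
      rw [Real.rpow_neg (by norm_num), Real.rpow_natCast, ← inv_pow, pow_succ]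
    rw [h6]
    have h7 : (0 : ℝ) < 4⁻¹ ^ c := by positivity
    nlinarith
  have f1 : (2 : ℝ) ^ x * (((a : ℝ) - q) / (2 * a)) ^ a < 1 / 2 := by
    calc (2 : ℝ) ^ x * (((a : ℝ) - q) / (2 * a)) ^ a
        ≤ 2 ^ x * (2 ^ (-(a : ℝ)) * 2 ^ (-y)) := by gcongr
      _ = 2 ^ (x + (-a + -y)) := by
        rw [← Real.rpow_add (by norm_num), ← Real.rpow_add (by norm_num)]
      _ < 2 ^ (-1 : ℝ) := Real.rpow_lt_rpow_of_exponent_lt (by norm_num) (by linarith)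
      _ = 1 / 2 := by rw [Real.rpow_neg_one]; norm_num
  have f2 : ((2 : ℝ) ^ x) ^ 2 * (2 * q * (1 / (2 * a) *
      (((2 * (a : ℝ) + 1) / (2 * (2 * a))) ^ 2) ^ (a - 1))) < 1 / 2 := by
    have h4 : ((2 : ℝ) ^ x) ^ 2 = 4 ^ x := by
      rw [← Real.rpow_natCast, ← Real.rpow_mul (by norm_num), mul_comm, Real.rpow_mul (by norm_num)]
      norm_num
    have h5 : (4 : ℝ) ^ (y / 2) = x := by
      rw [hxy, show (4 : ℝ) = 2 ^ (2 : ℝ) by norm_num, ← Real.rpow_mul (by norm_num)]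
      congr 1
      ring
    have hx0 : 0 < x := by rw [hxy]; positivity
    calc ((2 : ℝ) ^ x) ^ 2 * (2 * q * (1 / (2 * a) *
          (((2 * (a : ℝ) + 1) / (2 * (2 * a))) ^ 2) ^ (a - 1)))
        ≤ 4 ^ x * (2 * q * (1 / (2 * a) * (12 * 4 ^ (-(a : ℝ))))) := by
          rw [h4]; gcongr
      _ = 12 * q / a * 4 ^ (x - a) := by
          rw [sub_eq_add_neg, Real.rpow_add (by norm_num)]
          field_simp
      _ ≤ 12 * (y + 1) / (x / 2) * 4 ^ (y / 2 - √y) := by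
          have : (1 : ℝ) ≤ 4 := by norm_num
          have : x / 2 ≤ a := by linarith
          gcongr
      _ = 24 * (y + 1) * 4 ^ (-√y) := by
          rw [sub_eq_add_neg, Real.rpow_add (by norm_num), h5]
          field_simp
          norm_num
      _ < 1 / 2 := h1
  linarith

theorem eventually_loglog_conditions : ∀ᶠ y : ℝ in atTop,
    2 < y ∧ 24 * (y + 1) * 4 ^ (-√y) < 1 / 2 ∧ 10 * y ≤ 2 ^ y ∧ 20 ≤ (2 : ℝ) ^ y := by
  have t1 : Tendsto (fun y : ℝ => (2 : ℝ) ^ y) atTop atTop :=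
    tendsto_rpow_atTop_of_base_gt_one 2 (by norm_num)
  have hl4 : 0 < Real.log 4 := Real.log_pos (by norm_num)
  have hl2 : 0 < Real.log 2 := Real.log_pos (by norm_num)
  have t2 : Tendsto (fun z : ℝ => 24 * (z ^ 2 + 1) * 4 ^ (-z)) atTop (𝓝 0) := by
    have a1 := tendsto_rpow_mul_exp_neg_mul_atTop_nhds_zero 2 _ hl4
    have a2 := tendsto_rpow_mul_exp_neg_mul_atTop_nhds_zero 0 _ hl4
    have := (a1.add a2).const_mul 24
    simp only [Real.rpow_zero, one_mul, add_zero, mul_zero] at this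
    refine this.congr fun z => ?_
    rw [Real.rpow_def_of_pos (by norm_num : (0 : ℝ) < 4)]
    norm_num
    ring_nf
  have t3 : Tendsto (fun z : ℝ => 10 * z * 2 ^ (-z)) atTop (𝓝 0) := by
    have a1 := (tendsto_rpow_mul_exp_neg_mul_atTop_nhds_zero 1 _ hl2).const_mul 10
    simp only [Real.rpow_one, mul_zero] at a1
    refine a1.congr fun z => ?_
    rw [Real.rpow_def_of_pos (by norm_num : (0 : ℝ) < 2)]
    ring_nf
  filter_upwards [eventually_gt_atTop 2,
    (t2.comp Real.tendsto_sqrt_atTop).eventually_lt_const (by norm_num : (0 : ℝ) < 1 / 2),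
    t3.eventually_lt_const (by norm_num : (0 : ℝ) < 1), t1.eventually_ge_atTop 20]
    with y h1 h2 h3 h4
  refine ⟨h1, ?_, ?_, h4⟩
  · simpa [Real.sq_sqrt (by linarith : (0 : ℝ) ≤ y)] using h2
  · rw [Real.rpow_neg (by norm_num), ← div_eq_mul_inv, div_lt_one (by positivity)] at h3
    exact h3.le

theorem tendsto_logb_two_logb_two :
    Tendsto (fun n : ℕ => Real.logb 2 (Real.logb 2 n)) atTop atTop :=
  (Real.tendsto_logb_atTop (by norm_num)).comp
    ((Real.tendsto_logb_atTop (by norm_num)).comp tendsto_natCast_atTop_atTop)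

theorem eventually_strongFractionalChoiceNumber_le :
    ∀ᶠ n : ℕ in atTop, ∀ (V : Type*) [Fintype V] (G : SimpleGraph V),
      Fintype.card V = n → G.IsBipartite →
        strongFractionalChoiceNumber G ≤
          Real.logb 2 n - (1 / 2 - 1 / √(Real.logb 2 (Real.logb 2 n))) *
            Real.logb 2 (Real.logb 2 n) := by
  filter_upwards [tendsto_logb_two_logb_two.eventually eventually_loglog_conditions,
    eventually_gt_atTop 1] with n hn hn1 V _ G hV hG
  set x := Real.logb 2 n with hx
  set y := Real.logb 2 x with hy
  obtain ⟨h1, h2, h3, h4⟩ := hn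
  have hn0 : (1 : ℝ) < n := by exact_mod_cast hn1
  have hx0 : 0 < x := Real.logb_pos (by norm_num) hn0
  have hxy : x = 2 ^ y := (Real.rpow_logb (by norm_num) (by norm_num) hx0).symm
  have hnx : (Fintype.card V : ℝ) = 2 ^ x := by
    rw [hV, hx, Real.rpow_logb (by norm_num) (by norm_num) (by linarith)]
  rw [← hxy] at h3 h4
  have : Nonempty V := Fintype.card_pos_iff.1 (by omega)
  have hs : 0 ≤ √y := Real.sqrt_nonneg y
  have hr : x - (1 / 2 - 1 / √y) * y = x - y / 2 + √y := by
    have : 1 / √y * y = √y := by rw [one_div_mul_eq_div, Real.div_sqrt]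
    rw [sub_mul, this]
    ring
  rw [hr]
  refine (strongFractionalChoiceNumber_isGLB G).1 fun a b hb hab => ?_
  rw [le_div_iff₀ (by exact_mod_cast hb)] at hab
  rcases Nat.lt_or_ge b 2 with hb2 | hb2
  · obtain rfl : b = 1 := by omega
    rw [Nat.cast_one, mul_one] at hab
    exact isChoosable_one_of_log_bound hG hnx hxy h1 h2 hab (by linarith) (by linarith)
  · exact isChoosable_of_two_le hG hnx hb2 (by linarith) (by linarith) hab

/-! ### The painting game as a chip game -/

/-- `ChipProfile n k P`: Painter still wins the game on `K_{n,n}` from some position in which, for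
every side `s` and every `i`, at least `P s i` uncoloured vertices on side `s` have already lost `i`
of their `k` tokens. -/
def ChipProfile (n k : ℕ) (P : Bool → ℕ → ℕ) : Prop :=
  ∃ f g : Fin n ⊕ Fin n → ℕ, PainterWins (completeBipartiteGraph (Fin n) (Fin n)) f g ∧
    ∃ A : Bool → ℕ → Finset (Fin n ⊕ Fin n), ∀ s i, (A s i).card = P s i ∧
      ∀ v ∈ A s i, v.isLeft = s ∧ f v + i = k ∧ 0 < g v

theorem completeBipartiteGraph_adj_of_isLeft_eq_not {α β : Type*} {v w : α ⊕ β}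
    (h : w.isLeft = !v.isLeft) : (completeBipartiteGraph α β).Adj v w := by
  rcases v with v | v <;> rcases w with w | w <;> simp_all

/-- `a` shifted up by one level. -/
def levelShift (a : ℕ → ℕ) : ℕ → ℕ
  | 0 => 0
  | i + 1 => a i

namespace ChipProfile

variable {n k : ℕ} {P Q : Bool → ℕ → ℕ}

theorem mono (h : ChipProfile n k P) (hQ : ∀ s i, Q s i ≤ P s i) : ChipProfile n k Q := by
  obtain ⟨f, g, hw, A, hA⟩ := h
  have : ∀ s i, ∃ B ⊆ A s i, B.card = Q s i := fun s i =>
    Finset.exists_subset_card_eq ((hQ s i).trans (hA s i).1.ge)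
  choose B hB hBc using this
  exact ⟨f, g, hw, B, fun s i => ⟨hBc s i, fun v hv => (hA s i).2 v (hB s i hv)⟩⟩

/-- A chip on level `k` is a vertex without tokens that still needs a colour, so Lister would have
won. -/
theorem eq_zero_of_level_eq (h : ChipProfile n k P) (s : Bool) : P s k = 0 := by
  obtain ⟨f, g, hw, A, hA⟩ := h
  rw [← (hA s k).1, Finset.card_eq_zero, Finset.eq_empty_iff_forall_notMem]
  intro v hv
  obtain ⟨-, h1, h2⟩ := (hA s k).2 v hv
  have := hw.le v
  omega

/-- Chips below level `m` are forgotten; the others have at most `k` tokens left. This is what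
restarts the game for the second phase. -/
theorem rebase {m : ℕ} (h : ChipProfile n (k + m) P) : ChipProfile n k fun s i => P s (i + m) := by
  obtain ⟨f, g, hw, A, hA⟩ := h
  refine ⟨f, g, hw, fun s i => A s (i + m), fun s i => ⟨(hA s (i + m)).1, fun v hv => ?_⟩⟩
  obtain ⟨h0, h1, h2⟩ := (hA s (i + m)).2 v hv
  exact ⟨h0, by omega, h2⟩

theorem of_isPaintable (h : IsPaintable (completeBipartiteGraph (Fin n) (Fin n)) k 1) {N : ℕ}
    (hN : N ≤ n) : ChipProfile n k fun _ i => if i = 0 then N else 0 := by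
  refine mono (P := fun _ i => if i = 0 then n else 0)
    ⟨fun _ => k, fun _ => 1, h, fun s i => if i = 0 then
      (if s then Finset.univ.map Function.Embedding.inl else Finset.univ.map Function.Embedding.inr)
      else ∅, ?_⟩ ?_
  · intro s i
    by_cases hi : i = 0 <;> cases s <;> simp [hi]
  · intro s i
    by_cases hi : i = 0 <;> simp [hi, hN]

theorem round (h : ChipProfile n k P) (a : Bool → ℕ → ℕ) (ha : ∀ s i, a s i ≤ P s i) :
    ∃ s₀, ChipProfile n k fun s i => P s i - a s i + if s₀ = s then levelShift (a s) i else 0 := by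
  have hk := h.eq_zero_of_level_eq
  obtain ⟨f, g, hw, A, hA⟩ := h
  have : ∀ s i, ∃ B ⊆ A s i, B.card = a s i := fun s i =>
    Finset.exists_subset_card_eq ((ha s i).trans (hA s i).1.ge)
  choose B hB hBc using this
  set U : Set (Fin n ⊕ Fin n) := {v | ∃ s i, v ∈ B s i} with hU
  -- Lister may not choose the empty set; if nothing is offered, no round is played and the profile
  -- is already the required one.
  by_cases hne : U.Nonempty
  swap
  · refine ⟨true, f, g, hw, A, fun s i => ⟨?_, (hA s i).2⟩⟩
    have hz : ∀ s i, a s i = 0 := fun s i => by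
      rw [← hBc s i, Finset.card_eq_zero, Finset.eq_empty_iff_forall_notMem]
      exact fun v hv => hne ⟨v, s, i, hv⟩
    have hz' : levelShift (a s) i = 0 := by cases i <;> simp [levelShift, hz]
    simp [hz, hz', (hA s i).1]
  have hpos : ∀ v ∈ U, 0 < f v ∧ 0 < g v := by
    rintro v ⟨s, i, hv⟩
    obtain ⟨-, h1, h2⟩ := (hA s i).2 v (hB s i hv)
    refine ⟨Nat.pos_of_ne_zero fun h0 => ?_, h2⟩
    have hik : i = k := by omega
    subst hik
    have : a s i ≤ 0 := (ha s i).trans (hk s).le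
    rw [← hBc s i, Nat.le_zero, Finset.card_eq_zero] at this
    rw [this] at hv
    simp at hv
  have huniq : ∀ v s i s' i', v ∈ A s i → v ∈ A s' i' → s = s' ∧ i = i' := by
    intro v s i s' i' h1 h2
    obtain ⟨x1, y1, -⟩ := (hA s i).2 v h1
    obtain ⟨x2, y2, -⟩ := (hA s' i').2 v h2
    exact ⟨x1.symm.trans x2, by omega⟩
  cases hw with
  | done _ _ h0 =>
    obtain ⟨v, hv⟩ := hne
    have := (hpos v hv).2
    rw [h0 v] at this
    omega
  | round _ _ _ R hR hcont =>
    obtain ⟨hRU, hind⟩ := hR U hne fun v hv => (hpos v hv).1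
    have hnext := hcont U hne fun v hv => (hpos v hv).1
    -- An independent set meets at most one side; `s₀` is a side it misses, so the chips offered
    -- there advance uncoloured.
    have hside : ∃ s₀, ∀ v ∈ R U, v.isLeft ≠ s₀ := by
      by_cases hr : ∃ v, v ∈ R U
      · obtain ⟨v, hv⟩ := hr
        refine ⟨!v.isLeft, fun w hw hwv => ?_⟩
        have hvw : v ≠ w := by
          rintro rfl
          cases h : v.isLeft <;> simp [h] at hwv
        exact hind hv hw hvw (completeBipartiteGraph_adj_of_isLeft_eq_not hwv)
      · push Not at hr
        exact ⟨true, fun v hv => absurd hv (hr v)⟩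
    obtain ⟨s₀, hs₀⟩ := hside
    have hshift : ∃ D : Bool → ℕ → Finset (Fin n ⊕ Fin n), ∀ s i,
        (D s i).card = (if s₀ = s then levelShift (a s) i else 0) ∧
          ∀ v ∈ D s i, s = s₀ ∧ ∃ j, i = j + 1 ∧ v ∈ B s j := by
      refine ⟨fun s i => if s₀ = s then (match i with | 0 => ∅ | j + 1 => B s j) else ∅, ?_⟩
      intro s i
      by_cases hs : s₀ = s
      · cases i with
        | zero => simp [hs, levelShift]
        | succ j => simp [hs, levelShift, hBc]
      · simp [hs]
    obtain ⟨D, hD⟩ := hshift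
    refine ⟨s₀, _, _, hnext, fun s i => (A s i \ B s i) ∪ D s i, fun s i => ⟨?_, ?_⟩⟩
    · rw [Finset.card_union_of_disjoint, Finset.card_sdiff_of_subset (hB s i), (hA s i).1, hBc s i,
        (hD s i).1]
      rw [Finset.disjoint_left]
      intro v hv hv'
      obtain ⟨-, j, hj, hvj⟩ := (hD s i).2 v hv'
      have := (huniq v s i s j (Finset.mem_sdiff.1 hv).1 (hB s j hvj)).2
      omega
    · intro v hv
      rcases Finset.mem_union.1 hv with hv | hv
      · rw [Finset.mem_sdiff] at hv
        have hvU : v ∉ U := by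
          rintro ⟨s', i', hv'⟩
          obtain ⟨rfl, rfl⟩ := huniq v s i s' i' hv.1 (hB s' i' hv')
          exact hv.2 hv'
        have hvR : v ∉ R U := fun h => hvU (hRU h)
        simpa [hvU, hvR] using (hA s i).2 v hv.1
      · obtain ⟨hs, j, rfl, hvj⟩ := (hD s i).2 v hv
        obtain ⟨h1, h2, h3⟩ := (hA s j).2 v (hB s j hvj)
        have hvU : v ∈ U := ⟨s, j, hvj⟩
        have hvR : v ∉ R U := fun h => hs₀ v h (h1.trans hs)
        have := (hpos v hvU).1
        refine ⟨h1, ?_, ?_⟩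
        · simp [hvU]
          omega
        · simpa [hvR] using h3

end ChipProfile

/-! ### Lister's proportional strategy and its divisible model -/

/-- The number of chips on level `i` that are offered in each round: a `1 / (q + 1)` fraction below
level `μ`, nothing from level `μ` on. -/
def offered (μ q : ℕ) (c : ℕ → ℕ) (i : ℕ) : ℕ :=
  if i < μ then c i / (q + 1) else 0

theorem offered_le (μ q : ℕ) (c : ℕ → ℕ) (i : ℕ) : offered μ q c i ≤ c i := by
  unfold offered
  split_ifs
  · exact Nat.div_le_self _ _
  · exact Nat.zero_le _

/-- The numbers of chips on the levels of one side after `t` rounds; the chips offered in round `τ`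
advance if `adv τ`, and are lost otherwise. -/
def evolve (μ q : ℕ) (c : ℕ → ℕ) (adv : ℕ → Bool) : ℕ → ℕ → ℕ
  | 0 => c
  | t + 1 => fun i => evolve μ q c adv t i - offered μ q (evolve μ q c adv t) i +
      if adv t then levelShift (offered μ q (evolve μ q c adv t)) i else 0

theorem evolve_congr (μ q : ℕ) (c : ℕ → ℕ) {adv adv' : ℕ → Bool} {t : ℕ}
    (h : ∀ τ < t, adv τ = adv' τ) : evolve μ q c adv t = evolve μ q c adv' t := by
  induction t with
  | zero => rfl
  | succ t ih =>
    simp only [evolve]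
    rw [ih fun τ hτ => h τ (by omega), h t (by omega)]

theorem levelShift_add (a b : ℕ → ℕ) (i : ℕ) :
    levelShift (fun i => a i + b i) i = levelShift a i + levelShift b i := by
  cases i <;> rfl

/-- Two populations with different final levels are offered together, so one sequence `x` of answers
governs both. This lets one population discipline Painter on behalf of the other. -/
theorem ChipProfile.run {n k : ℕ} (μ ν q : ℕ) (c d : Bool → ℕ → ℕ)
    (h : ChipProfile n k fun s i => c s i + d s i) (T : ℕ) :
    ∃ x : ℕ → Bool, ∀ t ≤ T, ChipProfile n k fun s i =>
      evolve μ q (c s) (fun τ => x τ == s) t i + evolve ν q (d s) (fun τ => x τ == s) t i := by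
  induction T with
  | zero =>
    refine ⟨fun _ => true, fun t ht => ?_⟩
    obtain rfl : t = 0 := by omega
    exact h
  | succ T ih =>
    obtain ⟨x, hx⟩ := ih
    obtain ⟨s₀, hs₀⟩ := (hx T le_rfl).round
      (fun s i => offered μ q (evolve μ q (c s) (fun τ => x τ == s) T) i +
        offered ν q (evolve ν q (d s) (fun τ => x τ == s) T) i)
      (fun s i => add_le_add (offered_le _ _ _ _) (offered_le _ _ _ _))
    -- Recording the answer of round `T` leaves the first `T` rounds unchanged.
    have hc : ∀ t ≤ T, ∀ (μ : ℕ) (c : ℕ → ℕ) (s : Bool),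
        evolve μ q c (fun τ => Function.update x T s₀ τ == s) t =
          evolve μ q c (fun τ => x τ == s) t := by
      intro t ht μ c s
      refine evolve_congr _ _ _ fun τ hτ => ?_
      rw [Function.update_of_ne (by omega)]
    refine ⟨Function.update x T s₀, fun t ht => ?_⟩
    rcases Nat.lt_or_ge T t with htT | htT
    · obtain rfl : t = T + 1 := by omega
      refine hs₀.mono fun s i => ?_
      simp only [evolve, hc T le_rfl, Function.update_self, beq_iff_eq]
      rw [levelShift_add]
      have h1 := offered_le μ q (evolve μ q (c s) (fun τ => x τ == s) T) i
      have h2 := offered_le ν q (evolve ν q (d s) (fun τ => x τ == s) T) i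
      split_ifs <;> omega
    · simp only [hc t htT]
      exact hx t htT

/-- The fraction of chips that would be on level `i` after `t` rounds if chips were infinitely
divisible. -/
noncomputable def levelDensity (q : ℕ) (adv : ℕ → Bool) (t i : ℕ) : ℝ :=
  ((Nat.count (fun τ => adv τ = true) t).choose i : ℝ) / (q : ℝ) ^ i * ((q : ℝ) / (q + 1)) ^ t

theorem levelDensity_nonneg (q : ℕ) (adv : ℕ → Bool) (t i : ℕ) : 0 ≤ levelDensity q adv t i := by
  unfold levelDensity
  positivity

theorem levelDensity_zero (q : ℕ) (adv : ℕ → Bool) (i : ℕ) :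
    levelDensity q adv 0 i = if i = 0 then 1 else 0 := by
  unfold levelDensity
  cases i <;> simp

theorem levelDensity_succ_zero {q : ℕ} (hq : 0 < q) (adv : ℕ → Bool) (t : ℕ) :
    levelDensity q adv (t + 1) 0 = (1 - 1 / (q + 1)) * levelDensity q adv t 0 := by
  unfold levelDensity
  have : (q : ℝ) / (q + 1) = 1 - 1 / (q + 1) := by field_simp; ring
  rw [pow_succ, this]
  simp
  ring

theorem levelDensity_succ_succ {q : ℕ} (hq : 0 < q) (adv : ℕ → Bool) (t i : ℕ) :
    levelDensity q adv (t + 1) (i + 1) = (1 - 1 / (q + 1)) * levelDensity q adv t (i + 1) +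
      if adv t then 1 / (q + 1) * levelDensity q adv t i else 0 := by
  unfold levelDensity
  have : (q : ℝ) / (q + 1) = 1 - 1 / (q + 1) := by field_simp; ring
  have hq' : (0 : ℝ) < q := by exact_mod_cast hq
  rw [Nat.count_succ]
  by_cases h : adv t
  · simp only [h, if_true, Nat.choose_succ_succ]
    rw [pow_succ ((q : ℝ) / (q + 1)) t, ← this]
    push_cast
    field_simp
    ring
  · simp only [h, if_false, Bool.false_eq_true, add_zero]
    rw [pow_succ ((q : ℝ) / (q + 1)) t, this]
    ring

theorem div_add_one_cast_bounds (a q : ℕ) :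
    (1 / (q + 1) : ℝ) * a - 1 ≤ ((a / (q + 1) : ℕ) : ℝ) ∧
      ((a / (q + 1) : ℕ) : ℝ) ≤ (1 / (q + 1) : ℝ) * a := by
  constructor
  · have h := Nat.lt_div_mul_add (a := a) (b := q + 1) (by omega)
    have h' : (a : ℝ) ≤ (a / (q + 1) : ℕ) * (q + 1) + (q + 1) := by exact_mod_cast h.le
    have hq : (0 : ℝ) < q + 1 := by positivity
    rw [one_div_mul_eq_div, sub_le_iff_le_add, div_le_iff₀ hq]
    linarith
  · have := Nat.cast_div_le (α := ℝ) (m := a) (n := q + 1)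
    rw [one_div_mul_eq_div]
    exact_mod_cast this

/-- Below `μ` each round adds a rounding error of at most one per level. Nothing leaves level `μ`,
so the sum over past rounds restores the outflow that `levelDensity` subtracts there; the
accumulated errors total at most `t + t ^ 2`. -/
theorem evolve_ge {q μ N : ℕ} (hq : 0 < q) (hμ : 0 < μ) (adv : ℕ → Bool) (t : ℕ) :
    (∀ i < μ, N * levelDensity q adv t i - t ≤
      evolve μ q (fun i => if i = 0 then N else 0) adv t i) ∧
    N * (levelDensity q adv t μ + 1 / (q + 1) * ∑ τ ∈ Finset.range t, levelDensity q adv τ μ) -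
      (t + t ^ 2) ≤ evolve μ q (fun i => if i = 0 then N else 0) adv t μ := by
  set α : ℝ := 1 / (q + 1) with hα
  have hα0 : 0 < α := by positivity
  have hα1 : α ≤ 1 := by
    rw [hα, div_le_one (by positivity)]
    have : (0 : ℝ) ≤ q := by positivity
    linarith
  induction t with
  | zero =>
    constructor
    · intro i _
      rw [levelDensity_zero]
      by_cases h : i = 0 <;> simp [evolve, h]
    · rw [levelDensity_zero]
      simp [evolve, hμ.ne']
  | succ t ih =>
    obtain ⟨ih1, ih2⟩ := ih
    simp only [evolve]
    set c := evolve μ q (fun i => if i = 0 then N else 0) adv t with hc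
    have hshift : ∀ i, i < μ → (1 / (q + 1) : ℝ) * (N * levelDensity q adv t i - t) - 1 ≤
        levelShift (offered μ q c) (i + 1) := by
      intro i hi
      simp only [levelShift, offered, if_pos hi]
      have := (div_add_one_cast_bounds (c i) q).1
      have h2 := mul_le_mul_of_nonneg_left (ih1 i hi) hα0.le
      linarith
    have hstay : ∀ i, i < μ → (1 - α) * c i ≤ ((c i - offered μ q c i : ℕ) : ℝ) := by
      intro i hi
      rw [Nat.cast_sub (offered_le _ _ _ _)]
      simp only [offered, if_pos hi]
      have := (div_add_one_cast_bounds (c i) q).2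
      linarith
    constructor
    · intro i hi
      have h1 := hstay i hi
      have h2 := mul_le_mul_of_nonneg_left (ih1 i hi) (sub_nonneg.2 hα1)
      push_cast
      cases i with
      | zero =>
        rw [levelDensity_succ_zero hq]
        have h3 : (0 : ℝ) ≤ ((if adv t then levelShift (offered μ q c) 0 else 0 : ℕ) : ℝ) :=
          Nat.cast_nonneg _
        push_cast at h3
        have : (0 : ℝ) ≤ t := Nat.cast_nonneg t
        nlinarith
      | succ i =>
        rw [levelDensity_succ_succ hq]
        have h3 := hshift i (by omega)
        have : (0 : ℝ) ≤ t := Nat.cast_nonneg t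
        by_cases h : adv t
        · simp only [h, if_true]
          nlinarith
        · simp only [h, if_false, Bool.false_eq_true]
          nlinarith
    · obtain ⟨j, rfl⟩ : ∃ j, μ = j + 1 := ⟨μ - 1, by omega⟩
      have h3 := hshift j (by omega)
      have h0 : offered (j + 1) q c (j + 1) = 0 := by simp [offered]
      rw [h0, Nat.sub_zero, Finset.sum_range_succ, levelDensity_succ_succ hq]
      have ht : (0 : ℝ) ≤ t := Nat.cast_nonneg t
      have hαt : α * t ≤ t := mul_le_of_le_one_left ht hα1
      push_cast
      by_cases h : adv t
      · simp only [h, if_true]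
        nlinarith
      · simp only [h, if_false, Bool.false_eq_true]
        nlinarith

theorem count_add_count_not (x : ℕ → Bool) (t : ℕ) :
    Nat.count (fun τ => (x τ == true) = true) t + Nat.count (fun τ => (x τ == false) = true) t =
      t := by
  induction t with
  | zero => simp
  | succ t ih =>
    rw [Nat.count_succ, Nat.count_succ]
    cases h : x t <;> simp <;> simp at ih <;> omega

/-! ### Poisson estimates for the level densities -/

/-- The weight `y ^ i * e ^ (-y) / i!` of the Poisson distribution. -/
noncomputable def poissonWeight (i : ℕ) (y : ℝ) : ℝ := y ^ i * Real.exp (-y) / i.factorial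

theorem factorial_le_stirling {n : ℕ} (hn : 0 < n) :
    (n.factorial : ℝ) ≤ Real.exp 1 * √n * (n / Real.exp 1) ^ n := by
  obtain ⟨m, rfl⟩ : ∃ m, n = m + 1 := ⟨n - 1, by omega⟩
  have h := Stirling.stirlingSeq'_antitone (Nat.zero_le m)
  simp only [Function.comp, Nat.succ_eq_add_one, zero_add, Stirling.stirlingSeq_one] at h
  unfold Stirling.stirlingSeq at h
  have hpos : (0 : ℝ) < √(2 * (m + 1 : ℕ)) * (((m + 1 : ℕ) : ℝ) / Real.exp 1) ^ (m + 1) := by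
    positivity
  rw [div_le_iff₀ hpos] at h
  refine h.trans (le_of_eq ?_)
  rw [Real.sqrt_mul (by norm_num)]
  field_simp

theorem exp_le_one_add {z : ℝ} (hz : -(1 / 2) ≤ z) : Real.exp (z - 2 * z ^ 2) ≤ 1 + z := by
  have hp : 0 < 1 + z := by linarith
  rw [← Real.le_log_iff_exp_le hp]
  refine le_trans ?_ (Real.one_sub_inv_le_log_of_pos hp)
  have : 1 - (1 + z)⁻¹ = z - z ^ 2 * (1 + z)⁻¹ := by field_simp; ring
  rw [this]
  have h2 : (1 + z)⁻¹ ≤ 2 := by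
    rw [inv_le_comm₀ hp (by norm_num)]
    linarith
  nlinarith [sq_nonneg z]

/-- With `y = i (1 + z)` and `i z ^ 2 ≤ 1`, the factor `(1 + z) ^ i * exp (-i z)` is at least `exp
(-2)`, and Stirling's formula contributes `exp (-1) / √i`. -/
theorem poissonWeight_ge {i : ℕ} (hi : 4 ≤ i) {y : ℝ} (hy : |y - i| ≤ √i) :
    Real.exp (-3) / √i ≤ poissonWeight i y := by
  have hi0 : (0 : ℝ) < i := by exact_mod_cast (by omega : 0 < i)
  have hi4 : (4 : ℝ) ≤ i := by exact_mod_cast hi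
  have hs : √(i : ℝ) ≤ i / 2 := by
    rw [Real.sqrt_le_left (by linarith)]
    nlinarith
  set z : ℝ := (y - i) / i with hz
  have hyz : y = i * (1 + z) := by rw [hz]; field_simp; ring
  have hzi : i * z = y - i := by rw [hz]; field_simp
  have hz1 : -(1 / 2) ≤ z := by
    rw [hz, le_div_iff₀ hi0]
    have := (abs_le.1 hy).1
    linarith
  have hz2 : i * z ^ 2 ≤ 1 := by
    have h1 : (i * z) ^ 2 ≤ i := by
      rw [hzi, ← sq_abs]
      calc |y - i| ^ 2 ≤ √(i : ℝ) ^ 2 := by gcongr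
        _ = (i : ℝ) := Real.sq_sqrt hi0.le
    have h2 : i * (i * z ^ 2) ≤ i * 1 := by linarith [h1, (by ring : (i * z) ^ 2 = i * (i * z ^ 2))]
    exact le_of_mul_le_mul_left h2 hi0
  have h1 : Real.exp (i * z - 2) ≤ (1 + z) ^ i := by
    calc Real.exp (i * z - 2) ≤ Real.exp (i * (z - 2 * z ^ 2)) := Real.exp_le_exp.2 (by linarith)
      _ = Real.exp (z - 2 * z ^ 2) ^ i := Real.exp_nat_mul _ _
      _ ≤ (1 + z) ^ i := pow_le_pow_left₀ (Real.exp_pos _).le (exp_le_one_add hz1) _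
  unfold poissonWeight
  rw [div_le_div_iff₀ (by positivity) (by positivity)]
  have h3 : Real.exp (-y) = Real.exp (-(i * z)) * Real.exp (-1) ^ i := by
    rw [← Real.exp_nat_mul, ← Real.exp_add]
    congr 1
    linarith
  calc Real.exp (-3) * i.factorial
      ≤ Real.exp (-3) * (Real.exp 1 * √i * (i / Real.exp 1) ^ i) := by
        gcongr
        exact factorial_le_stirling (by omega)
    _ = i ^ i * Real.exp (i * z - 2) * (Real.exp (-(i * z)) * Real.exp (-1) ^ i) * √i := by
        have e1 : Real.exp (i * z - 2) * Real.exp (-(i * z)) = Real.exp (-3) * Real.exp 1 := by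
          rw [← Real.exp_add, ← Real.exp_add]
          congr 1
          ring
        rw [div_pow, Real.exp_neg 1, inv_pow, div_eq_mul_inv]
        linear_combination (-((i : ℝ) ^ i * (Real.exp 1 ^ i)⁻¹ * √(i : ℝ))) * e1
    _ ≤ i ^ i * (1 + z) ^ i * (Real.exp (-(i * z)) * Real.exp (-1) ^ i) * √i := by gcongr
    _ = y ^ i * Real.exp (-y) * √i := by
        rw [h3, ← mul_pow, ← hyz]

theorem levelDensity_ge {q : ℕ} (hq : 0 < q) (adv : ℕ → Bool) (t i : ℕ) {v : ℝ} (hv : 0 ≤ v)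
    (h : q * v + i ≤ Nat.count (fun τ => adv τ = true) t) :
    v ^ i / i.factorial * Real.exp (-(t / q)) ≤ levelDensity q adv t i := by
  have hq' : (0 : ℝ) < q := by exact_mod_cast hq
  unfold levelDensity
  set r := Nat.count (fun τ => adv τ = true) t with hr
  have hir : i ≤ r := by
    have : (i : ℝ) ≤ r := by
      have : 0 ≤ q * v := by positivity
      linarith
    exact_mod_cast this
  have h1 : (q * v) ^ i / i.factorial ≤ (r.choose i : ℝ) := by
    refine le_trans ?_ (Nat.pow_le_choose i r)
    have h2 : q * v ≤ ((r + 1 - i : ℕ) : ℝ) := by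
      rw [Nat.cast_sub (by omega)]
      push_cast
      linarith
    gcongr
  refine mul_le_mul ?_ ?_ (Real.exp_pos _).le (by positivity)
  · rw [le_div_iff₀ (by positivity)]
    refine le_trans (le_of_eq ?_) h1
    rw [mul_pow]
    ring
  · have h3 : (q : ℝ) / (q + 1) = ((q + 1) / q : ℝ)⁻¹ := by rw [inv_div]
    rw [h3, inv_pow, Real.exp_neg]
    refine inv_anti₀ (by positivity) ?_
    have h4 : ((q : ℝ) + 1) / q ≤ Real.exp (1 / q) := by
      have := Real.add_one_le_exp (1 / (q : ℝ))
      refine le_trans (le_of_eq ?_) this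
      field_simp
      ring
    calc (((q : ℝ) + 1) / q) ^ t ≤ Real.exp (1 / q) ^ t := by gcongr
      _ = Real.exp (t / q) := by
        rw [← Real.exp_nat_mul]
        congr 1
        ring

theorem levelDensity_ge_poissonWeight {q : ℕ} (hq : 0 < q) (adv : ℕ → Bool) (t i : ℕ) {z e : ℝ}
    (hz : 0 ≤ 1 + z)
    (h : t / 2 * (1 + z) + i ≤ (Nat.count (fun τ => adv τ = true) t : ℝ))
    (he : e ≤ (1 + z) ^ i) :
    (1 / 2) ^ i * poissonWeight i (t / q) * e ≤ levelDensity q adv t i := by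
  have hq' : (0 : ℝ) < q := by exact_mod_cast hq
  have h0 : (0 : ℝ) ≤ t / q := by positivity
  refine le_trans ?_ (levelDensity_ge hq adv t i (v := t / q / 2 * (1 + z)) (by positivity) ?_)
  · unfold poissonWeight
    calc (1 / 2 : ℝ) ^ i * ((t / q : ℝ) ^ i * Real.exp (-(t / q)) / i.factorial) * e
        ≤ (1 / 2 : ℝ) ^ i * ((t / q : ℝ) ^ i * Real.exp (-(t / q)) / i.factorial) * (1 + z) ^ i := by
          gcongr
      _ = _ := by
          rw [mul_pow, div_pow (t / q : ℝ) 2, div_pow 1 2, one_pow]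
          ring
  · refine le_trans (le_of_eq ?_) h
    field_simp

/-- Of the lead `q D`, one `q` pays for the shift by `i ≤ q`; since `t / 2 ≤ i q`, the rest is a
relative lead `(D - 1) / i`, amplified by the `i`-th power. -/
theorem levelDensity_ge_of_ahead {q : ℕ} (hq : 0 < q) (adv : ℕ → Bool) {t i : ℕ} {D : ℝ}
    (hiq : i ≤ q) (hi : 0 < i) (hD : 1 ≤ D) (hDi : D ≤ i) (ht : 0 < t) (hti : (t : ℝ) ≤ 2 * i * q)
    (h : t / 2 + q * D ≤ (Nat.count (fun τ => adv τ = true) t : ℝ)) :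
    (1 / 2) ^ i * poissonWeight i (t / q) * Real.exp ((D - 1) / 2) ≤ levelDensity q adv t i := by
  have hq' : (0 : ℝ) < q := by exact_mod_cast hq
  have hi' : (0 : ℝ) < i := by exact_mod_cast hi
  have ht' : (0 : ℝ) < t := by exact_mod_cast ht
  have hiq' : (i : ℝ) ≤ q := by exact_mod_cast hiq
  set z : ℝ := (D - 1) / i with hz
  have hz0 : 0 ≤ z := div_nonneg (by linarith) hi'.le
  have hz1 : z ≤ 1 := by rw [hz, div_le_one hi']; linarith
  refine levelDensity_ge_poissonWeight hq adv t i (z := z) (by linarith) ?_ ?_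
  · refine le_trans ?_ h
    have h1 : t / 2 * z ≤ q * (D - 1) := by
      have : t / 2 * z ≤ i * q * z := by
        refine mul_le_mul_of_nonneg_right (by linarith) hz0
      refine this.trans (le_of_eq ?_)
      rw [hz]
      field_simp
    nlinarith
  · have hp : 0 < 1 + z := by linarith
    have h1 : Real.exp (z / 2) ≤ 1 + z := by
      rw [← Real.le_log_iff_exp_le hp]
      refine le_trans ?_ (Real.one_sub_inv_le_log_of_pos hp)
      have h2 : 1 - (1 + z)⁻¹ = z / (1 + z) := by field_simp; ring
      rw [h2]
      exact div_le_div_of_nonneg_left hz0 hp (by linarith)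
    refine le_trans (le_of_eq ?_) (pow_le_pow_left₀ (Real.exp_pos _).le h1 i)
    rw [← Real.exp_nat_mul]
    congr 1
    rw [hz]
    field_simp

/-- The deficit, including the shift by `i ≤ q`, is relatively at most `4 (D + 1) / i`; its `i`-th
power costs a factor depending only on `D`. -/
theorem levelDensity_ge_of_not_behind {q : ℕ} (hq : 0 < q) (adv : ℕ → Bool) {t i : ℕ} {D : ℝ}
    (hiq : i ≤ q) (hi : 0 < i) (hD : 0 ≤ D) (hDi : 8 * (D + 1) ≤ i) (hti : (i : ℝ) * q ≤ 2 * t)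
    (h : t / 2 - q * D ≤ (Nat.count (fun τ => adv τ = true) t : ℝ)) :
    (1 / 2) ^ i * poissonWeight i (t / q) * Real.exp (-(8 * (D + 1))) ≤ levelDensity q adv t i := by
  have hq' : (0 : ℝ) < q := by exact_mod_cast hq
  have hi' : (0 : ℝ) < i := by exact_mod_cast hi
  have hiq' : (i : ℝ) ≤ q := by exact_mod_cast hiq
  set x : ℝ := 4 * (D + 1) / i with hx
  have hx0 : 0 ≤ x := by positivity
  have hx1 : x ≤ 1 / 2 := by rw [hx, div_le_iff₀ hi']; linarith
  refine levelDensity_ge_poissonWeight hq adv t i (z := -x) (by linarith) ?_ ?_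
  · refine le_trans ?_ h
    have h1 : q * (D + 1) ≤ t / 2 * x := by
      have : i * q / 4 * x ≤ t / 2 * x := mul_le_mul_of_nonneg_right (by linarith) hx0
      refine le_trans (le_of_eq ?_) this
      rw [hx]
      field_simp
    nlinarith
  · have h1 := exp_le_one_add (z := -x) (by linarith)
    have h2 : Real.exp (-(2 * x)) ≤ 1 + -x :=
      (Real.exp_le_exp.2 (by nlinarith)).trans h1
    refine le_trans (le_of_eq ?_) (pow_le_pow_left₀ (Real.exp_pos _).le h2 i)
    rw [← Real.exp_nat_mul]
    congr 1
    rw [hx]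
    field_simp
    ring

/-- The lead of one side is the deficit of the other, so the imbalance enters the product only
quadratically: relative loss of order `D ^ 2 / i ^ 2`, hence a constant factor after the `i`-th
power. -/
theorem levelDensity_mul_ge {q : ℕ} (adv adv' : ℕ → Bool) {t i : ℕ} {D : ℝ}
    (hiq : 32 * i ≤ q) (hD : 1 ≤ D) (hDi : 32 * D ^ 2 ≤ i) (hti : (i : ℝ) * q ≤ 2 * t)
    (hsum : Nat.count (fun τ => adv τ = true) t + Nat.count (fun τ => adv' τ = true) t = t)
    (h : t / 2 - q * D ≤ (Nat.count (fun τ => adv τ = true) t : ℝ))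
    (h' : t / 2 - q * D ≤ (Nat.count (fun τ => adv' τ = true) t : ℝ)) :
    ((1 / 2) ^ i * poissonWeight i (t / q) * (1 / 2)) ^ 2 ≤
      levelDensity q adv t i * levelDensity q adv' t i := by
  have hi' : (32 : ℝ) ≤ i := by nlinarith
  have hiq' : (32 : ℝ) * i ≤ q := by exact_mod_cast hiq
  have hq' : (0 : ℝ) < q := by linarith
  have hq : 0 < q := by exact_mod_cast hq'
  have ht' : (0 : ℝ) < t := by nlinarith
  set r := Nat.count (fun τ => adv τ = true) t with hr
  set p := Nat.count (fun τ => adv' τ = true) t with hp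
  have hrp : (r : ℝ) + p = t := by exact_mod_cast hsum
  -- `r - i` and `p - i`, relative to `t / 2`
  set a : ℝ := ((r : ℝ) - i) / q with ha
  set b : ℝ := ((p : ℝ) - i) / q with hb
  have hDi2 : 32 * D ≤ i := by nlinarith
  have hbase : (i : ℝ) ≤ t / 2 - q * D := by nlinarith
  have ha0 : 0 ≤ a := div_nonneg (by linarith) hq'.le
  have hb0 : 0 ≤ b := div_nonneg (by linarith) hq'.le
  have h1 := levelDensity_ge hq adv t i ha0 (by rw [ha]; field_simp; rw [← hr]; linarith)
  have h2 := levelDensity_ge hq adv' t i hb0 (by rw [hb]; field_simp; rw [← hp]; linarith)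
  refine le_trans ?_ (mul_le_mul h1 h2 (by positivity) (levelDensity_nonneg _ _ _ _))
  set y : ℝ := t / q with hy
  have hy0 : 0 < y := by positivity
  have hyi : (i : ℝ) / 2 ≤ y := by
    rw [hy, le_div_iff₀ hq']
    linarith
  -- From `4 a b = (a + b) ^ 2 - (a - b) ^ 2`: the shift by `i` loses a fraction at most `1 / (4 i)`
  -- and the imbalance at most `1 / (2 i)`.
  have key : (y / 2) ^ 2 * (1 - 3 / (4 * i)) ≤ a * b := by
    have e1 : a + b = y - 2 * (i / q) := by
      rw [ha, hb, hy, ← hrp]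
      field_simp
      ring
    have e2 : |a - b| ≤ 2 * D := by
      have : a - b = (r - p) / q := by rw [ha, hb]; field_simp; ring
      rw [this, abs_div, abs_of_pos hq', div_le_iff₀ hq', abs_le]
      constructor <;> linarith
    have e3 : (a - b) ^ 2 ≤ 4 * D ^ 2 := by
      rw [← sq_abs]
      nlinarith [abs_nonneg (a - b)]
    have e4 : (i : ℝ) / q ≤ 1 / 32 := by
      rw [div_le_iff₀ hq']
      linarith
    have e5 : 4 * (a * b) = (a + b) ^ 2 - (a - b) ^ 2 := by ring
    have e6 : y ^ 2 - 4 * y * (i / q) - 4 * D ^ 2 ≤ 4 * (a * b) := by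
      have e10 : (y - 2 * ((i : ℝ) / q)) ^ 2 =
          y ^ 2 - 4 * y * (i / q) + 4 * ((i : ℝ) / q) ^ 2 := by ring
      rw [e5, e1, e10]
      linarith [sq_nonneg ((i : ℝ) / q)]
    have e7 : 4 * y * (i / q) ≤ y ^ 2 * (1 / (4 * i)) := by
      rw [mul_one_div, le_div_iff₀ (by linarith)]
      have e11 : 16 * (i * ((i : ℝ) / q)) ≤ y := by
        have := mul_le_mul_of_nonneg_left e4 (by linarith : (0 : ℝ) ≤ i)
        linarith
      have e12 := mul_le_mul_of_nonneg_left e11 hy0.le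
      linarith
    have e8 : 4 * D ^ 2 ≤ y ^ 2 * (1 / (2 * i)) := by
      rw [mul_one_div, le_div_iff₀ (by linarith)]
      have e11 := mul_le_mul_of_nonneg_right hDi (by linarith : (0 : ℝ) ≤ i)
      have e12 := mul_le_mul hyi hyi (by linarith) hy0.le
      linarith
    have e9 : (3 : ℝ) / (4 * i) = 1 / (4 * i) + 1 / (2 * i) := by
      field_simp
      norm_num
    rw [e9]
    linarith
  have hbern : (1 / 4 : ℝ) ≤ (1 - 3 / (4 * i)) ^ i := by
    have h3 : (-2 : ℝ) ≤ -(3 / (4 * i)) := by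
      have : (3 : ℝ) / (4 * i) ≤ 2 := by
        rw [div_le_iff₀ (by linarith)]
        linarith
      linarith
    have := one_add_mul_le_pow h3 i
    rw [← sub_eq_add_neg] at this
    refine le_trans (le_of_eq ?_) this
    field_simp
    norm_num
  have hpos1 : (0 : ℝ) ≤ 1 - 3 / (4 * i) := by
    have : (3 : ℝ) / (4 * i) ≤ 1 := by
      rw [div_le_iff₀ (by linarith)]
      linarith
    linarith
  have hpow : ((y / 2) ^ i) ^ 2 * (1 / 4) ≤ a ^ i * b ^ i := by
    calc ((y / 2) ^ i) ^ 2 * (1 / 4) ≤ ((y / 2) ^ i) ^ 2 * (1 - 3 / (4 * i)) ^ i := by gcongr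
      _ = ((y / 2) ^ 2 * (1 - 3 / (4 * i))) ^ i := by rw [mul_pow, ← pow_mul, ← pow_mul, mul_comm i]
      _ ≤ (a * b) ^ i := pow_le_pow_left₀ (by positivity) key i
      _ = a ^ i * b ^ i := mul_pow _ _ _
  unfold poissonWeight
  calc ((1 / 2) ^ i * (y ^ i * Real.exp (-y) / i.factorial) * (1 / 2)) ^ 2
      = ((y / 2) ^ i) ^ 2 * (1 / 4) * (Real.exp (-y) / i.factorial) ^ 2 := by
        rw [div_pow y 2, div_pow 1 2, one_pow]
        ring
    _ ≤ a ^ i * b ^ i * (Real.exp (-y) / i.factorial) ^ 2 := by gcongr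
    _ = _ := by ring

/-! ### The two phases of Lister's strategy -/

theorem mul_levelDensity_le {μ q N : ℕ} (hq : 0 < q) (hμ : 0 < μ) (adv : ℕ → Bool) (t : ℕ)
    (h : evolve μ q (fun i => if i = 0 then N else 0) adv t μ = 0) :
    N * levelDensity q adv t μ ≤ t + t ^ 2 := by
  have h1 := (evolve_ge (N := N) hq hμ adv t).2
  rw [h, mul_add] at h1
  have h2 : (0 : ℝ) ≤ N * (1 / (q + 1) * ∑ τ ∈ Finset.range t, levelDensity q adv τ μ) :=
    mul_nonneg (Nat.cast_nonneg _)
      (mul_nonneg (by positivity) (Finset.sum_nonneg fun τ _ => levelDensity_nonneg _ _ _ _))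
  push_cast at h1
  linarith

/-- A position from which Lister wins: all chips are on level zero, and the numbers of chips on the
two sides have a large product and are not too small. -/
theorem ChipProfile.false_of_large {n c : ℕ} {Z : Bool → ℕ} {D : ℝ}
    (h : ChipProfile n c fun s i => if i = 0 then Z s else 0)
    (hc : 32 ≤ c) (hD : 1 ≤ D) (hDc : 32 * D ^ 2 ≤ c)
    (h1 : ∀ s, 2 * (c : ℝ) ^ 6 <
      Z s * ((1 / 2) ^ c * (Real.exp (-3) / √c) * Real.exp ((D - 1) / 2)))
    (h2 : (2 * (c : ℝ) ^ 6) ^ 2 <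
      Z true * Z false * ((1 / 2) ^ c * (Real.exp (-3) / √c) * (1 / 2)) ^ 2) : False := by
  obtain ⟨x, hx⟩ := ChipProfile.run c c (c ^ 2) (fun s i => if i = 0 then Z s else 0)
    (fun _ _ => 0) (by simpa using h) (c ^ 3)
  have hc0 : (32 : ℝ) ≤ c := by exact_mod_cast hc
  have hq : 0 < c ^ 2 := by positivity
  have hDc' : D ≤ c := by nlinarith
  have hup : ∀ s : Bool, Z s * levelDensity (c ^ 2) (fun τ => x τ == s) (c ^ 3) c ≤
      2 * (c : ℝ) ^ 6 := by
    intro s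
    have h0 := (hx _ le_rfl).eq_zero_of_level_eq s
    refine (mul_levelDensity_le hq (by omega) _ _ (by omega)).trans ?_
    push_cast
    have : (c : ℝ) ^ 3 ≤ c ^ 6 := pow_le_pow_right₀ (by linarith) (by norm_num)
    nlinarith
  have hy : (((c ^ 3 : ℕ) : ℝ) / ((c ^ 2 : ℕ) : ℝ)) = c := by
    push_cast
    field_simp
  have hw : Real.exp (-3) / √c ≤ poissonWeight c (((c ^ 3 : ℕ) : ℝ) / ((c ^ 2 : ℕ) : ℝ)) := by
    rw [hy]
    exact poissonWeight_ge (by omega) (by simp)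
  -- A side this far ahead would have a chip on level `c`, by `h1`.
  have hnot : ∀ s : Bool, (Nat.count (fun τ => (x τ == s) = true) (c ^ 3) : ℝ) <
      (c ^ 3 : ℕ) / 2 + (c ^ 2 : ℕ) * D := by
    intro s
    by_contra hcon
    push Not at hcon
    have h3 := levelDensity_ge_of_ahead hq (fun τ => x τ == s) (t := c ^ 3) (i := c) (D := D)
      (by nlinarith) (by omega) hD hDc' (by positivity) (by push_cast; nlinarith [pow_pos (by linarith : (0 : ℝ) < c) 3]) hcon
    have h4 := (h1 s).trans_le (mul_le_mul_of_nonneg_left (le_trans (by gcongr) h3)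
      (Nat.cast_nonneg (Z s)))
    exact absurd (hup s) (not_le.2 h4)
  have hsum := count_add_count_not x (c ^ 3)
  have hsum' : (Nat.count (fun τ => (x τ == true) = true) (c ^ 3) : ℝ) +
      Nat.count (fun τ => (x τ == false) = true) (c ^ 3) = (c ^ 3 : ℕ) := by exact_mod_cast hsum
  -- Neither side is far ahead, so neither is far behind, and the product bound puts a chip on level
  -- `c` on some side.
  have h5 := levelDensity_mul_ge (q := c ^ 2) (fun τ => x τ == true) (fun τ => x τ == false)
    (t := c ^ 3) (i := c) (D := D) (by nlinarith) hD hDc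
    (by push_cast; nlinarith [pow_pos (by linarith : (0 : ℝ) < c) 3]) hsum
    (by linarith [hnot false]) (by linarith [hnot true])
  have h6 := mul_le_mul (hup true) (hup false)
    (mul_nonneg (Nat.cast_nonneg _) (levelDensity_nonneg _ _ _ _)) (by positivity)
  have h7 : (Z true : ℝ) * Z false * ((1 / 2) ^ c * (Real.exp (-3) / √c) * (1 / 2)) ^ 2 ≤
      Z true * Z false * (levelDensity (c ^ 2) (fun τ => x τ == true) (c ^ 3) c *
        levelDensity (c ^ 2) (fun τ => x τ == false) (c ^ 3) c) := by
    refine mul_le_mul_of_nonneg_left (le_trans ?_ h5) (by positivity)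
    gcongr
  nlinarith

theorem half_sqrt_le_nat_sqrt {m : ℕ} (hm : 4 ≤ m) : √(m : ℝ) / 2 ≤ Nat.sqrt m := by
  have h1 : √(m : ℝ) ≤ Nat.sqrt m + 1 := Real.real_sqrt_le_nat_sqrt_succ
  have h2 : (2 : ℝ) ≤ √m := by
    rw [Real.le_sqrt (by norm_num) (by positivity)]
    have : (4 : ℝ) ≤ m := by exact_mod_cast hm
    linarith
  linarith

/-- Half of the chips are led to level `k`, which forces Painter to treat the two sides almost
equally, and half of them are collected on level `m`. -/
theorem ChipProfile.exists_collected {n k m N : ℕ} {D : ℝ}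
    (h : ChipProfile n k fun _ i => (if i = 0 then N else 0) + if i = 0 then N else 0)
    (hk : 32 ≤ k) (hmk : m ≤ k) (hkm : (k : ℝ) - m ≤ √k) (hD : 1 ≤ D) (hDm : 32 * D ^ 2 ≤ m)
    (hA : 8 * (k : ℝ) ^ 6 <
      N * ((1 / 2) ^ k * (Real.exp (-3) / √k) * Real.exp ((D - 1) / 2))) :
    ∃ (Z : Bool → ℕ) (M : Bool → ℝ), (ChipProfile n k fun s i => if i = m then Z s else 0) ∧
      (∀ s, M s - 8 * (k : ℝ) ^ 6 ≤ Z s) ∧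
      (∀ s, N / 4 * ((1 / 2) ^ m * Real.exp (-3) * Real.exp (-(8 * (D + 1)))) ≤ M s) ∧
      (N / 4 * ((1 / 2) ^ m * Real.exp (-3) * (1 / 2))) ^ 2 ≤ M true * M false := by
  have hk' : (32 : ℝ) ≤ k := by exact_mod_cast hk
  have hm32 : (32 : ℝ) ≤ m := by nlinarith
  have hm32' : 32 ≤ m := by exact_mod_cast hm32
  have hmk' : (m : ℝ) ≤ k := by exact_mod_cast hmk
  have hDm' : 32 * D ≤ m := by nlinarith
  set w := Nat.sqrt m with hw
  have hwm : w ≤ m := Nat.sqrt_le_self m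
  have hwm' : (w : ℝ) ≤ m := by exact_mod_cast hwm
  set q := k ^ 2 with hqdef
  have hq : 0 < q := by positivity
  have hq' : (0 : ℝ) < q := by exact_mod_cast hq
  have hqk : ((q : ℕ) : ℝ) = (k : ℝ) ^ 2 := by rw [hqdef]; push_cast; ring
  set T := q * m + q * w with hT
  have hTk : (T : ℝ) ≤ 2 * k * q := by
    rw [hT]
    push_cast
    nlinarith
  -- The first population heads for level `k` and punishes imbalance; the second stops and
  -- accumulates on level `m`.
  obtain ⟨x, hx⟩ := ChipProfile.run k m q (fun _ i => if i = 0 then N else 0)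
    (fun _ i => if i = 0 then N else 0) h T
  have herr : ∀ t ≤ T, (t : ℝ) + (t : ℝ) ^ 2 ≤ 8 * (k : ℝ) ^ 6 := by
    intro t ht
    have h1 : (t : ℝ) ≤ 2 * k ^ 3 := by
      have : (t : ℝ) ≤ T := by exact_mod_cast ht
      rw [hqk] at hTk
      nlinarith
    have h2 : (t : ℝ) ^ 2 ≤ (2 * k ^ 3) ^ 2 := by gcongr
    have h3 : (k : ℝ) ^ 3 ≤ k ^ 6 := pow_le_pow_right₀ (by linarith) (by norm_num)
    nlinarith
  have hsk : √(m : ℝ) ≤ √k := Real.sqrt_le_sqrt hmk'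
  have hwin : ∀ t, q * m ≤ t → t < T →
      (m : ℝ) ≤ (t : ℝ) / q ∧ (t : ℝ) / q - m ≤ √(m : ℝ) := by
    intro t ht1 ht2
    have h1 : (q : ℝ) * m ≤ t := by exact_mod_cast ht1
    have h2 : (t : ℝ) ≤ q * m + q * w := by exact_mod_cast ht2.le
    have h3 : (w : ℝ) ≤ √m := Real.nat_sqrt_le_real_sqrt
    constructor
    · rw [le_div_iff₀ hq']
      linarith
    · refine le_trans ?_ h3
      rw [sub_le_iff_le_add, div_le_iff₀ hq']
      linarith
  -- As `k - m ≤ √k`, the Poisson weight at level `k` is of order `1 / √k` throughout the window, so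
  -- a lead in any of its rounds would bring a chip of the first population to level `k`.
  have hnot : ∀ t, q * m ≤ t → t < T → ∀ s : Bool,
      (Nat.count (fun τ => (x τ == s) = true) t : ℝ) < t / 2 + q * D := by
    intro t ht1 ht2 s
    by_contra hcon
    push Not at hcon
    obtain ⟨h1, h2⟩ := hwin t ht1 ht2
    have h3 := levelDensity_ge_of_ahead hq (fun τ => x τ == s) (t := t) (i := k) (D := D)
      (by nlinarith) (by omega) hD (by linarith)
      (lt_of_lt_of_le (by positivity) ht1)
      (le_trans (by exact_mod_cast ht2.le) hTk) hcon
    have hwt : Real.exp (-3) / √k ≤ poissonWeight k ((t : ℝ) / q) :=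
      poissonWeight_ge (by omega) (abs_le.2 ⟨by linarith, by linarith⟩)
    have h0 := (hx t ht2.le).eq_zero_of_level_eq s
    have h4 := mul_levelDensity_le hq (by omega : 0 < k) (fun τ => x τ == s) t
      (N := N) (by omega)
    have h5 := hA.trans_le (mul_le_mul_of_nonneg_left (le_trans (by gcongr) h3)
      (Nat.cast_nonneg N))
    linarith [herr t ht2.le]
  have hlow : ∀ t, q * m ≤ t → t < T → ∀ s : Bool,
      t / 2 - q * D ≤ (Nat.count (fun τ => (x τ == s) = true) t : ℝ) := by
    intro t ht1 ht2 s
    have hsum' : (Nat.count (fun τ => (x τ == true) = true) t : ℝ) +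
      Nat.count (fun τ => (x τ == false) = true) t = t := by exact_mod_cast count_add_count_not x t
    have h1 := hnot t ht1 ht2 true
    have h2 := hnot t ht1 ht2 false
    cases s <;> linarith
  set κ : ℝ := Real.exp (-3) / √m with hκ
  have hκ0 : 0 < κ := by
    have : (0 : ℝ) < √m := Real.sqrt_pos.2 (by linarith)
    positivity
  have hwt : ∀ t, q * m ≤ t → t < T → κ ≤ poissonWeight m ((t : ℝ) / q) := by
    intro t ht1 ht2
    obtain ⟨h1, h2⟩ := hwin t ht1 ht2
    exact poissonWeight_ge (by omega) (abs_le.2 ⟨by linarith, by linarith⟩)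
  have hmq : ∀ t, q * m ≤ t → (m : ℝ) * q ≤ 2 * t := by
    intro t ht1
    have : (q : ℝ) * m ≤ t := by exact_mod_cast ht1
    nlinarith
  have hmq32 : 32 * m ≤ q := by
    rw [hqdef, sq]
    exact Nat.mul_le_mul hk hmk
  set W := Finset.Ico (q * m) T with hW
  have hWc : (W.card : ℝ) = q * w := by
    rw [hW, Nat.card_Ico, hT, Nat.add_sub_cancel_left]
    push_cast
    ring
  -- The window has `q w` rounds with `w ≥ √m / 2`, cancelling the Poisson factor `1 / √m`; the
  -- other factor is `q / (q + 1) ≥ 1 / 2`.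
  have hfrac : (1 : ℝ) / 4 ≤ 1 / (q + 1) * (q * w) * (1 / √m) := by
    have h1 := half_sqrt_le_nat_sqrt (m := m) (by omega)
    have h2 : (0 : ℝ) < √m := Real.sqrt_pos.2 (by linarith)
    have h3 : (1 : ℝ) ≤ q := by exact_mod_cast hq
    rw [one_div_mul_eq_div, mul_one_div, div_div, div_le_div_iff₀ (by norm_num) (by positivity)]
    have h4 : (q : ℝ) * (√m / 2) ≤ q * w := mul_le_mul_of_nonneg_left h1 hq'.le
    nlinarith
  have hfrac' : ∀ e : ℝ, 0 ≤ e → (N : ℝ) / 4 * ((1 / 2) ^ m * Real.exp (-3) * e) ≤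
      N * (1 / (q + 1) * (q * w * ((1 / 2) ^ m * κ * e))) := by
    intro e he
    have h1 := mul_le_mul_of_nonneg_left hfrac
      (by positivity : (0 : ℝ) ≤ N * ((1 / 2) ^ m * Real.exp (-3) * e))
    rw [hκ]
    refine le_trans (le_of_eq ?_) (h1.trans (le_of_eq ?_))
    · ring
    · ring
  -- `M s` is the divisible model's contribution of the window alone; `Z s` is the actual number on
  -- level `m`.
  refine ⟨fun s => evolve m q (fun i => if i = 0 then N else 0) (fun τ => x τ == s) T m,
    fun s => N * (1 / (q + 1) * ∑ τ ∈ W, levelDensity q (fun τ => x τ == s) τ m), ?_, ?_, ?_, ?_⟩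
  · refine (hx T le_rfl).mono fun s i => ?_
    by_cases hi : i = m
    · subst hi
      simp
    · simp [hi]
  · intro s
    have h1 := (evolve_ge (N := N) hq (by omega : 0 < m) (fun τ => x τ == s) T).2
    refine le_trans ?_ h1
    have h2 : ∑ τ ∈ W, levelDensity q (fun τ => x τ == s) τ m ≤
        ∑ τ ∈ Finset.range T, levelDensity q (fun τ => x τ == s) τ m := by
      refine Finset.sum_le_sum_of_subset_of_nonneg ?_ fun τ _ _ => levelDensity_nonneg _ _ _ _
      intro t ht
      exact Finset.mem_range.2 (Finset.mem_Ico.1 ht).2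
    have h3 := levelDensity_nonneg q (fun τ => x τ == s) T m
    have h4 : (N : ℝ) * (1 / (q + 1) * ∑ τ ∈ W, levelDensity q (fun τ => x τ == s) τ m) ≤
        N * (levelDensity q (fun τ => x τ == s) T m +
          1 / (q + 1) * ∑ τ ∈ Finset.range T, levelDensity q (fun τ => x τ == s) τ m) := by
      refine mul_le_mul_of_nonneg_left ?_ (Nat.cast_nonneg N)
      have := mul_le_mul_of_nonneg_left h2 (by positivity : (0 : ℝ) ≤ 1 / (q + 1))
      linarith
    linarith [herr T le_rfl]
  · intro s
    refine (hfrac' _ (Real.exp_pos _).le).trans ?_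
    refine mul_le_mul_of_nonneg_left (mul_le_mul_of_nonneg_left ?_ (by positivity))
      (Nat.cast_nonneg N)
    rw [← hWc, ← nsmul_eq_mul]
    refine Finset.card_nsmul_le_sum _ _ _ fun t ht => ?_
    rw [hW, Finset.mem_Ico] at ht
    have h3 := levelDensity_ge_of_not_behind hq (fun τ => x τ == s) (t := t) (i := m) (D := D)
      (by omega) (by omega) (by linarith) (by linarith) (hmq t ht.1) (hlow t ht.1 ht.2 s)
    refine le_trans ?_ h3
    have := hwt t ht.1 ht.2
    gcongr
  · have hsq : (q * w * ((1 / 2) ^ m * κ * (1 / 2))) ^ 2 ≤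
        (∑ τ ∈ W, levelDensity q (fun τ => x τ == true) τ m) *
          ∑ τ ∈ W, levelDensity q (fun τ => x τ == false) τ m := by
      have h1 : q * w * ((1 / 2) ^ m * κ * (1 / 2)) ≤ ∑ τ ∈ W,
          √(levelDensity q (fun τ => x τ == true) τ m *
            levelDensity q (fun τ => x τ == false) τ m) := by
        rw [← hWc, ← nsmul_eq_mul]
        refine Finset.card_nsmul_le_sum _ _ _ fun t ht => ?_
        rw [hW, Finset.mem_Ico] at ht
        refine Real.le_sqrt_of_sq_le ?_
        have h3 := levelDensity_mul_ge (q := q) (fun τ => x τ == true) (fun τ => x τ == false)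
          (t := t) (i := m) (D := D) hmq32 hD hDm (hmq t ht.1) (count_add_count_not x t)
          (hlow t ht.1 ht.2 true) (hlow t ht.1 ht.2 false)
        refine le_trans ?_ h3
        have := hwt t ht.1 ht.2
        gcongr
      refine (pow_le_pow_left₀ (by positivity) h1 2).trans ?_
      refine Finset.sum_sq_le_sum_mul_sum_of_sq_le_mul _ (fun τ _ => levelDensity_nonneg _ _ _ _)
        (fun τ _ => levelDensity_nonneg _ _ _ _) fun τ _ => ?_
      exact (Real.sq_sqrt (mul_nonneg (levelDensity_nonneg _ _ _ _)
        (levelDensity_nonneg _ _ _ _))).le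
    calc (N / 4 * ((1 / 2) ^ m * Real.exp (-3) * (1 / 2))) ^ 2
        ≤ (N * (1 / (q + 1) * (q * w * ((1 / 2) ^ m * κ * (1 / 2))))) ^ 2 := by
          refine pow_le_pow_left₀ (by positivity) (hfrac' _ (by norm_num)) 2
      _ = (N * (1 / (q + 1))) ^ 2 * (q * w * ((1 / 2) ^ m * κ * (1 / 2))) ^ 2 := by ring
      _ ≤ (N * (1 / (q + 1))) ^ 2 * _ := mul_le_mul_of_nonneg_left hsq (by positivity)
      _ = _ := by ring

set_option maxHeartbeats 1000000 in
/-- The complete bipartite graph with `2 * 2 ^ k * k ^ (1 / 3)` vertices on each side, up to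
rounding, is not `(k, 1)`-paintable when `k` is large. -/
theorem not_isPaintable_completeBipartiteGraph {u k n : ℕ} (hu : 100 ≤ u)
    (hexp : (2 * (u : ℝ)) ^ 1000 ≤ Real.exp (u / 4)) (hk1 : u ^ 120 ≤ k) (hk2 : k ≤ (2 * u) ^ 120)
    (hn : 2 * (2 ^ k * u ^ 40) ≤ n) :
    ¬ IsPaintable (completeBipartiteGraph (Fin n) (Fin n)) k 1 := by
  intro hpaint
  have hu' : (100 : ℝ) ≤ u := by exact_mod_cast hu
  have hu1 : 1 ≤ u := by omega
  -- As `k` is of order `u ^ 120`, the factor `u ^ 40` is of order `k ^ (1/3)`. The second phase has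
  -- `c = u ^ 5` tokens, enough for `32 D ^ 2 ≤ c` with `D = u ^ 2`.
  set N := 2 ^ k * u ^ 40 with hN
  set c := u ^ 5 with hc
  have hcu : (c : ℝ) = (u : ℝ) ^ 5 := by rw [hc]; push_cast; ring
  have hu4 : (32 : ℝ) * u ^ 4 ≤ c := by
    rw [hcu]
    have : (0 : ℝ) < (u : ℝ) ^ 4 := by positivity
    nlinarith
  have hu2 : (100 : ℝ) * u ≤ (u : ℝ) ^ 2 := by nlinarith
  have hu24 : (u : ℝ) ^ 2 * 10000 ≤ (u : ℝ) ^ 4 := by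
    have : (10000 : ℝ) ≤ (u : ℝ) ^ 2 := by nlinarith
    nlinarith
  have hcc : c * c ≤ k := by
    refine le_trans ?_ hk1
    rw [hc, ← pow_add]
    exact Nat.pow_le_pow_right hu1 (by norm_num)
  have hc32' : (32 : ℝ) ≤ c := by nlinarith
  have hc32 : 32 ≤ c := by exact_mod_cast hc32'
  have hck : 2 * c ≤ k := by nlinarith
  obtain ⟨m, hm⟩ : ∃ m, k = c + m := ⟨k - c, by omega⟩
  have hcm : c ≤ m := by omega
  have hcm' : (c : ℝ) ≤ m := by exact_mod_cast hcm
  have hkm' : (k : ℝ) = c + m := by exact_mod_cast hm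
  have hcc' : (c : ℝ) * c ≤ k := by exact_mod_cast hcc
  have hk1' : (1 : ℝ) ≤ k := by nlinarith
  set E := Real.exp (u / 4) with hE
  have hE1 : 26 ≤ E := by
    have := Real.add_one_le_exp ((u : ℝ) / 4)
    linarith
  have hexpu : Real.exp u = E ^ 4 := by
    rw [hE, ← Real.exp_nat_mul]
    congr 1
    push_cast
    ring
  have hEu : 64 * E < Real.exp u := by
    rw [hexpu]
    have : (676 : ℝ) ≤ E ^ 2 := by nlinarith
    have : (676 : ℝ) * 676 ≤ E ^ 2 * E ^ 2 := by nlinarith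
    nlinarith
  have hpow : ∀ j ≤ 1000, (2 * (u : ℝ)) ^ j ≤ E := fun j hj =>
    (pow_le_pow_right₀ (by linarith) hj).trans hexp
  have hk7 : (k : ℝ) ^ 7 ≤ E := by
    have h1 : (k : ℝ) ≤ (2 * (u : ℝ)) ^ 120 := by exact_mod_cast hk2
    calc (k : ℝ) ^ 7 ≤ ((2 * (u : ℝ)) ^ 120) ^ 7 := by gcongr
      _ = (2 * (u : ℝ)) ^ 840 := by rw [← pow_mul]
      _ ≤ E := hpow _ (by norm_num)
  have hk6 : (k : ℝ) ^ 6 ≤ E := (pow_le_pow_right₀ hk1' (by norm_num)).trans hk7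
  have hc7 : (c : ℝ) ^ 7 ≤ E := by
    calc (c : ℝ) ^ 7 = (u : ℝ) ^ 35 := by rw [hcu, ← pow_mul]
      _ ≤ (2 * (u : ℝ)) ^ 35 := by gcongr; linarith
      _ ≤ E := hpow _ (by norm_num)
  have hu40 : (1 : ℝ) ≤ (u : ℝ) ^ 40 := one_le_pow₀ (by linarith)
  have hNk : (N : ℝ) * (1 / 2) ^ k = (u : ℝ) ^ 40 := by
    rw [hN]
    push_cast
    rw [div_pow, one_pow]
    field_simp
  have hNm : (N : ℝ) * (1 / 2) ^ m = 2 ^ c * (u : ℝ) ^ 40 := by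
    rw [hN, hm]
    push_cast
    rw [div_pow, one_pow, pow_add]
    field_simp
  have hsqrt : ∀ x : ℝ, 1 ≤ x → 0 < √x ∧ √x ≤ x := fun x hx =>
    ⟨Real.sqrt_pos.2 (by linarith), by rw [Real.sqrt_le_left (by linarith)]; nlinarith⟩
  obtain ⟨hsk0, hsk⟩ := hsqrt k hk1'
  obtain ⟨hsc0, hsc⟩ := hsqrt c (by linarith)
  have hA : 8 * (k : ℝ) ^ 6 <
      N * ((1 / 2) ^ k * (Real.exp (-3) / √k) * Real.exp (((u : ℝ) - 1) / 2)) := by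
    have h1 : (N : ℝ) * ((1 / 2) ^ k * (Real.exp (-3) / √k) * Real.exp (((u : ℝ) - 1) / 2)) =
        (u : ℝ) ^ 40 * Real.exp (-3 + ((u : ℝ) - 1) / 2) / √k := by
      rw [← hNk, Real.exp_add]
      ring
    have h2 : 8 * E < Real.exp (-3 + ((u : ℝ) - 1) / 2) := by
      have h3 : Real.exp (-3 + ((u : ℝ) - 1) / 2) = E * Real.exp (u / 4 - 7 / 2) := by
        rw [hE, ← Real.exp_add]
        congr 1
        ring
      rw [h3]
      have := Real.add_one_le_exp ((u : ℝ) / 4 - 7 / 2)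
      nlinarith
    rw [h1, lt_div_iff₀ hsk0]
    calc 8 * (k : ℝ) ^ 6 * √k ≤ 8 * (k : ℝ) ^ 6 * k := by gcongr
      _ = 8 * (k : ℝ) ^ 7 := by ring
      _ ≤ 8 * E := by linarith
      _ < 1 * Real.exp (-3 + ((u : ℝ) - 1) / 2) := by linarith
      _ ≤ _ := by gcongr
  have hstart : ChipProfile n k fun _ i => (if i = 0 then N else 0) + if i = 0 then N else 0 := by
    refine (ChipProfile.of_isPaintable hpaint hn).mono fun s i => ?_
    by_cases hi : i = 0 <;> simp [hi, two_mul]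
  have hkm : (k : ℝ) - m ≤ √k := by
    have : (k : ℝ) - m = c := by linarith
    rw [this]
    exact Real.le_sqrt_of_sq_le (by rw [sq]; exact hcc')
  -- With `D = u` the gain `exp ((u - 1) / 2)` outweighs the powers of `k` in the rounding error.
  obtain ⟨Z, M, hprof, hZM, hM, hMM⟩ := hstart.exists_collected (m := m) (D := u)
    (by omega) (by omega) hkm (by linarith) (by nlinarith) hA
  rw [hm] at hprof
  have hprof' := hprof.rebase
  have hprof2 : ChipProfile n c fun s i => if i = 0 then Z s else 0 := by
    refine hprof'.mono fun s i => ?_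
    by_cases hi : i = 0 <;> simp [hi]
  have h2c : Real.exp ((c : ℝ) / 2) ≤ 2 ^ c := by
    have h1 : Real.exp (1 / 2) ≤ 2 := by
      have h2 : Real.exp (1 / 2) ^ 2 ≤ 2 ^ 2 := by
        rw [← Real.exp_nat_mul]
        norm_num
        linarith [Real.exp_one_lt_d9]
      exact le_of_pow_le_pow_left₀ two_ne_zero (by norm_num) h2
    calc Real.exp ((c : ℝ) / 2) = Real.exp (1 / 2) ^ c := by
          rw [← Real.exp_nat_mul]
          congr 1
          ring
      _ ≤ 2 ^ c := by gcongr
  have hMge : ∀ s, 2 ^ c / 4 * Real.exp (-(8 * u + 11)) ≤ M s := by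
    intro s
    refine le_trans ?_ (hM s)
    have h1 : (N : ℝ) / 4 * ((1 / 2) ^ m * Real.exp (-3) * Real.exp (-(8 * (u + 1)))) =
        2 ^ c / 4 * Real.exp (-(8 * u + 11)) * (u : ℝ) ^ 40 := by
      have h3 : Real.exp (-(8 * (u : ℝ) + 11)) = Real.exp (-3) * Real.exp (-(8 * (u + 1))) := by
        rw [← Real.exp_add]
        congr 1
        ring
      rw [h3]
      linear_combination (1 / 4 * Real.exp (-3) * Real.exp (-(8 * ((u : ℝ) + 1)))) * hNm
    rw [h1]
    exact le_mul_of_one_le_right (by positivity) hu40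
  have hMbig : ∀ s, 16 * (k : ℝ) ^ 6 ≤ M s := by
    intro s
    refine le_trans ?_ (hMge s)
    have h1 : Real.exp u ≤ 2 ^ c * Real.exp (-(8 * u + 11)) := by
      calc Real.exp u ≤ Real.exp ((c : ℝ) / 2 + -(8 * u + 11)) :=
            Real.exp_le_exp.2 (by linarith)
        _ = Real.exp ((c : ℝ) / 2) * Real.exp (-(8 * u + 11)) := Real.exp_add _ _
        _ ≤ _ := by gcongr
    linarith
  have hZ : ∀ s, M s / 2 ≤ Z s := fun s => by linarith [hZM s, hMbig s]
  have hM0 : ∀ s, 0 < M s := fun s => lt_of_lt_of_le (by positivity) (hMge s)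
  have hP : (1 / 2 : ℝ) ^ c * 2 ^ c = 1 := by rw [← mul_pow]; norm_num
  refine hprof2.false_of_large (D := (u : ℝ) ^ 2) hc32 (by nlinarith)
    (by rw [← pow_mul]; exact hu4) ?_ ?_
  · intro s
    have h1 : 2 ^ c / 8 * Real.exp (-(8 * u + 11)) ≤ (Z s : ℝ) := by
      linarith [hZ s, hMge s]
    -- In the second phase `exp (u ^ 2 / 2)` outweighs the factor `exp (-(8 u + 11))` that one side
    -- may have lost in the first.
    have h2 : 64 * E < Real.exp (-(8 * u + 11) + -3 + ((u : ℝ) ^ 2 - 1) / 2) := by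
      refine hEu.trans_le (Real.exp_le_exp.2 ?_)
      linarith
    calc 2 * (c : ℝ) ^ 6
        < Real.exp (-(8 * u + 11) + -3 + ((u : ℝ) ^ 2 - 1) / 2) / (8 * √c) := by
          rw [lt_div_iff₀ (by positivity)]
          calc 2 * (c : ℝ) ^ 6 * (8 * √c) ≤ 2 * (c : ℝ) ^ 6 * (8 * c) := by gcongr
            _ = 16 * (c : ℝ) ^ 7 := by ring
            _ ≤ 64 * E := by linarith
            _ < _ := h2
      _ = 2 ^ c / 8 * Real.exp (-(8 * u + 11)) *
          ((1 / 2) ^ c * (Real.exp (-3) / √c) * Real.exp (((u : ℝ) ^ 2 - 1) / 2)) := by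
          rw [Real.exp_add, Real.exp_add]
          linear_combination (-(1 / 8 * Real.exp (-(8 * u + 11)) * Real.exp (-3) *
            Real.exp (((u : ℝ) ^ 2 - 1) / 2) / √c)) * hP
      _ ≤ _ := by gcongr
  · have h1 : M true * M false / 4 ≤ Z true * Z false := by
      have := mul_le_mul (hZ true) (hZ false) (by linarith [hM0 false]) (Nat.cast_nonneg _)
      linarith
    have h2 : (2 ^ c * (u : ℝ) ^ 40 * Real.exp (-3) / 16) ^ 2 ≤ Z true * Z false := by
      refine le_trans ?_ h1
      have h3 : (N : ℝ) / 4 * ((1 / 2) ^ m * Real.exp (-3) * (1 / 2)) =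
          2 ^ c * (u : ℝ) ^ 40 * Real.exp (-3) / 8 := by
        linear_combination (1 / 8 * Real.exp (-3)) * hNm
      rw [h3] at hMM
      linarith
    have h4 : (u : ℝ) ^ 80 * Real.exp (-12) / (1024 * c) =
        (2 ^ c * (u : ℝ) ^ 40 * Real.exp (-3) / 16) ^ 2 *
          ((1 / 2) ^ c * (Real.exp (-3) / √c) * (1 / 2)) ^ 2 := by
      have h5 : Real.exp (-12) = Real.exp (-3) ^ 4 := by
        rw [← Real.exp_nat_mul]
        norm_num
      have h6 : √(c : ℝ) ^ 2 = c := Real.sq_sqrt (by linarith)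
      rw [h5]
      calc (u : ℝ) ^ 80 * Real.exp (-3) ^ 4 / (1024 * c)
          = ((1 / 2) ^ c * 2 ^ c) ^ 2 * ((u : ℝ) ^ 80 * Real.exp (-3) ^ 4 / (1024 * √c ^ 2)) := by
            rw [hP, h6]
            ring
        _ = _ := by ring
    refine lt_of_lt_of_le ?_ (mul_le_mul_of_nonneg_right h2 (sq_nonneg _))
    rw [← h4, lt_div_iff₀ (by positivity), Real.exp_neg, ← div_eq_mul_inv,
      lt_div_iff₀ (Real.exp_pos _)]
    have h7 : Real.exp 12 ≤ 3 ^ 12 := by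
      have : Real.exp 12 = Real.exp 1 ^ 12 := by
        rw [← Real.exp_nat_mul]
        norm_num
      rw [this]
      have := Real.exp_one_lt_d9
      gcongr
      linarith
    have h8 : (100 : ℝ) ^ 15 ≤ (u : ℝ) ^ 15 := by gcongr
    -- The decisive comparison: rounding and Poisson losses amount to `c ^ 13 = u ^ 65` against the
    -- supply `(u ^ 40) ^ 2`; the spare `u ^ 15` covers the constants.
    calc (2 * (c : ℝ) ^ 6) ^ 2 * (1024 * c) * Real.exp 12
        ≤ (2 * (c : ℝ) ^ 6) ^ 2 * (1024 * c) * 3 ^ 12 := by gcongr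
      _ = 4096 * 3 ^ 12 * (u : ℝ) ^ 65 := by rw [hcu]; ring
      _ < (u : ℝ) ^ 15 * (u : ℝ) ^ 65 := by
          gcongr
          refine lt_of_lt_of_le ?_ h8
          norm_num
      _ = (u : ℝ) ^ 80 := by rw [← pow_add]

/-! ### Asymptotics of the paint number and conclusion -/

theorem le_strongFractionalPaintNumber {V : Type*} [Fintype V] [Nonempty V] {G : SimpleGraph V}
    {k : ℕ} (h : ¬ IsPaintable G k 1) : (k : ℝ) ≤ strongFractionalPaintNumber G := by
  refine (strongFractionalPaintNumber_isGLB G).2 fun r hr => ?_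
  by_contra hlt
  exact h (hr k 1 one_pos (by simpa using (not_le.1 hlt).le))

theorem eventually_pow_le_exp : ∀ᶠ u : ℕ in atTop,
    (2 * (u : ℝ)) ^ 1000 ≤ Real.exp (u / 4) := by
  have h := (Real.tendsto_pow_mul_exp_neg_atTop_nhds_zero 1000).const_mul ((8 : ℝ) ^ 1000)
  rw [mul_zero] at h
  have t : Tendsto (fun u : ℕ => (u : ℝ) / 4) atTop atTop :=
    tendsto_natCast_atTop_atTop.atTop_div_const (by norm_num)
  filter_upwards [(h.comp t).eventually_lt_const one_pos] with u hu
  simp only [Function.comp] at hu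
  rw [Real.exp_neg, ← mul_assoc, ← mul_pow, ← div_eq_mul_inv, div_lt_one (Real.exp_pos _)] at hu
  refine le_trans (le_of_eq ?_) hu.le
  congr 1
  ring

theorem eventually_le_strongFractionalPaintNumber : ∀ᶠ n : ℕ in atTop,
    Real.logb 2 n - 42 - 1 / 3 * Real.logb 2 (Real.logb 2 n) ≤
      strongFractionalPaintNumber (completeBipartiteGraph (Fin n) (Fin n)) := by
  have hlog : Tendsto (fun n : ℕ => Nat.log 2 n) atTop atTop := by
    refine tendsto_atTop_atTop.2 fun b => ⟨2 ^ b, fun n hn => ?_⟩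
    exact Nat.le_log_of_pow_le (by norm_num) hn
  have hroot : Tendsto (fun n : ℕ => ⌊((Nat.log 2 n : ℝ) / 2) ^ (1 / 120 : ℝ)⌋₊) atTop atTop :=
    tendsto_nat_floor_atTop.comp ((tendsto_rpow_atTop (by norm_num)).comp
      ((tendsto_natCast_atTop_atTop.comp hlog).atTop_div_const (by norm_num)))
  filter_upwards [hroot.eventually (eventually_pow_le_exp.and (eventually_ge_atTop 100)),
    eventually_gt_atTop 1] with n hn hn1
  set l := Nat.log 2 n with hl
  -- Halving `l` leaves room to subtract `e ≤ u ^ 120` below and keep `u ^ 120 ≤ k`.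
  set u := ⌊((l : ℝ) / 2) ^ (1 / 120 : ℝ)⌋₊ with hu
  obtain ⟨hexp, hu100⟩ := hn
  have hl0 : (0 : ℝ) ≤ (l : ℝ) / 2 := by positivity
  have hrpow : (((l : ℝ) / 2) ^ (1 / 120 : ℝ)) ^ 120 = (l : ℝ) / 2 := by
    rw [← Real.rpow_natCast, ← Real.rpow_mul hl0]
    norm_num
  have h1 : 2 * u ^ 120 ≤ l := by
    have h2 : (u : ℝ) ^ 120 ≤ (l : ℝ) / 2 := by
      rw [← hrpow]
      exact pow_le_pow_left₀ (by positivity) (Nat.floor_le (by positivity)) 120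
    have h3 : (2 * u ^ 120 : ℝ) ≤ l := by linarith
    exact_mod_cast h3
  have h2 : l ≤ 2 * (u + 1) ^ 120 := by
    have h2 : (l : ℝ) / 2 ≤ ((u : ℝ) + 1) ^ 120 := by
      conv_lhs => rw [← hrpow]
      exact pow_le_pow_left₀ (by positivity) (Nat.lt_floor_add_one _).le 120
    have h3 : (l : ℝ) ≤ 2 * (u + 1) ^ 120 := by
      rwa [div_le_iff₀ two_pos, mul_comm] at h2
    exact_mod_cast h3
  -- Chosen so that `2 * 2 ^ (l - e) * u ^ 40 ≤ 2 ^ l`.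
  set e := 1 + 40 * (Nat.log 2 u + 1) with he
  have he1 : e ≤ u ^ 120 := by
    have h3 : Nat.log 2 u ≤ u := Nat.log_le_self 2 u
    have h4 : u ^ 2 ≤ u ^ 120 := Nat.pow_le_pow_right (by omega) (by norm_num)
    refine le_trans ?_ h4
    calc e ≤ 100 * u := by omega
      _ ≤ u * u := Nat.mul_le_mul_right u hu100
      _ = u ^ 2 := (sq u).symm
  obtain ⟨k, hk⟩ : ∃ k, l = k + e := ⟨l - e, by omega⟩
  have hnot : ¬ IsPaintable (completeBipartiteGraph (Fin n) (Fin n)) k 1 := by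
    refine not_isPaintable_completeBipartiteGraph hu100 hexp (by omega) ?_ ?_
    · have h3 : 2 * (u + 1) ≤ 3 * u := by omega
      have h4 := Nat.pow_le_pow_left h3 120
      rw [mul_pow, mul_pow] at h4
      have h5 : 2 * (3 : ℕ) ^ 120 ≤ 2 ^ 120 * 2 ^ 120 := by norm_num
      have h6 : 2 ^ 120 * l ≤ 2 ^ 120 * (2 * u) ^ 120 := by
        rw [mul_pow]
        generalize (u + 1) ^ 120 = A at h2 h4
        generalize u ^ 120 = B at h4
        generalize 3 ^ 120 = a at h4 h5
        generalize 2 ^ 120 = b at h4 h5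
        nlinarith [Nat.mul_le_mul_left b h2, Nat.mul_le_mul_right B h5]
      exact (by omega : k ≤ l).trans (Nat.le_of_mul_le_mul_left h6 (by positivity))
    · have h3 : u ^ 40 ≤ 2 ^ (40 * (Nat.log 2 u + 1)) := by
        rw [mul_comm 40, pow_mul]
        exact Nat.pow_le_pow_left (Nat.lt_pow_succ_log_self (by norm_num) u).le 40
      calc 2 * (2 ^ k * u ^ 40) ≤ 2 * (2 ^ k * 2 ^ (40 * (Nat.log 2 u + 1))) := by gcongr
        _ = 2 ^ l := by rw [hk, he, pow_add, pow_add]; ring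
        _ ≤ n := Nat.pow_log_le_self 2 (by omega)
  have : NeZero n := ⟨by omega⟩
  refine le_trans ?_ (le_strongFractionalPaintNumber hnot)
  have hl_le : (l : ℝ) ≤ Real.logb 2 n := by
    rw [Real.le_logb_iff_rpow_le (by norm_num) (by positivity), Real.rpow_natCast]
    exact_mod_cast Nat.pow_log_le_self 2 (by omega)
  have hl_ge : Real.logb 2 n ≤ l + 1 := by
    rw [Real.logb_le_iff_le_rpow (by norm_num) (by positivity)]
    have := (Nat.lt_pow_succ_log_self (b := 2) (by norm_num) n).le
    have h3 : (n : ℝ) ≤ 2 ^ (l + 1) := by exact_mod_cast this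
    exact_mod_cast h3
  have hlu : (Nat.log 2 u : ℝ) ≤ Real.logb 2 u := by
    rw [Real.le_logb_iff_rpow_le (by norm_num) (by positivity), Real.rpow_natCast]
    exact_mod_cast Nat.pow_log_le_self 2 (by omega)
  have hu120 : 120 * Real.logb 2 u ≤ Real.logb 2 (Real.logb 2 n) := by
    rw [show (120 : ℝ) = (120 : ℕ) by norm_num, ← Real.logb_pow]
    refine Real.logb_le_logb_of_le (by norm_num) (by positivity) (le_trans ?_ hl_le)
    have : u ^ 120 ≤ l := by omega
    exact_mod_cast this
  have hkr : (l : ℝ) = k + (1 + 40 * (Nat.log 2 u + 1)) := by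
    rw [hk, he]
    push_cast
    ring
  linarith

theorem tendsto_strongFractionalPaintNumber_sub_strongFractionalChoiceNumber :
    Tendsto
      (fun n : ℕ =>
        strongFractionalPaintNumber (completeBipartiteGraph (Fin n) (Fin n)) -
          strongFractionalChoiceNumber (completeBipartiteGraph (Fin n) (Fin n)))
      atTop atTop := by
  have hdouble : Tendsto (fun n : ℕ => n + n) atTop atTop :=
    tendsto_atTop_mono (fun n => Nat.le_add_right n n) tendsto_id
  -- Here `z` is `√(log₂ log₂ (2 n))` and `1/6 = 1/2 - 1/3`; the constant is `42 + 1`, because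
  -- `K_{n,n}` has `2 n` vertices.
  have hlow : Tendsto (fun z : ℝ => 1 / 6 * z ^ 2 - z - 43) atTop atTop := by
    have h1 : Tendsto (fun z : ℝ => z * (1 / 6 * z - 1)) atTop atTop :=
      tendsto_id.atTop_mul_atTop₀ (tendsto_atTop_add_const_right _ _
        (tendsto_id.const_mul_atTop (by norm_num)))
    refine (tendsto_atTop_add_const_right _ (-43) h1).congr fun z => ?_
    ring
  refine tendsto_atTop_mono' _ ?_
    (hlow.comp (Real.tendsto_sqrt_atTop.comp (tendsto_logb_two_logb_two.comp hdouble)))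
  filter_upwards [eventually_le_strongFractionalPaintNumber,
    hdouble.eventually eventually_strongFractionalChoiceNumber_le.{0},
    (tendsto_logb_two_logb_two.comp hdouble).eventually_gt_atTop 0,
    eventually_gt_atTop 1] with n hpaint hchoice hpos hn1
  have hbip : (completeBipartiteGraph (Fin n) (Fin n)).IsBipartite :=
    (SimpleGraph.CompleteBipartiteGraph.bicoloring (Fin n) (Fin n)).colorable
  have hc := hchoice (Fin n ⊕ Fin n) (completeBipartiteGraph (Fin n) (Fin n)) (by simp) hbip
  simp only [Function.comp] at hpos ⊢
  have hn0 : (1 : ℝ) < n := by exact_mod_cast hn1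
  have hx : 0 < Real.logb 2 n := Real.logb_pos (by norm_num) hn0
  have hx' : Real.logb 2 ((n + n : ℕ) : ℝ) = Real.logb 2 n + 1 := by
    push_cast
    rw [← two_mul, Real.logb_mul (by norm_num) (by linarith), Real.logb_self_eq_one (by norm_num),
      add_comm]
  have hyy : Real.logb 2 (Real.logb 2 n) ≤ Real.logb 2 (Real.logb 2 ((n + n : ℕ) : ℝ)) :=
    Real.logb_le_logb_of_le (by norm_num) hx (by linarith)
  set y := Real.logb 2 (Real.logb 2 ((n + n : ℕ) : ℝ)) with hy
  have hsq : √y ^ 2 = y := Real.sq_sqrt hpos.le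
  have hdiv : 1 / √y * y = √y := by rw [one_div_mul_eq_div, Real.div_sqrt]
  rw [hx', sub_mul, hdiv] at hc
  rw [hsq]
  linarith

theorem mainTheorem4 :
    (∃ ε : ℕ → ℝ, Tendsto ε atTop (𝓝 0) ∧
      ∀ᶠ n : ℕ in atTop, ∀ (V : Type*) [Fintype V] (G : SimpleGraph V),
        Fintype.card V = n → G.IsBipartite →
          strongFractionalChoiceNumber G ≤
            Real.logb 2 n - (1 / 2 - ε n) * Real.logb 2 (Real.logb 2 n)) ∧
    Tendsto
      (fun n : ℕ =>
        strongFractionalPaintNumber (completeBipartiteGraph (Fin n) (Fin n)) -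
          strongFractionalChoiceNumber (completeBipartiteGraph (Fin n) (Fin n)))
      atTop atTop := by
  refine ⟨⟨fun n => 1 / √(Real.logb 2 (Real.logb 2 n)), ?_,
    eventually_strongFractionalChoiceNumber_le⟩,
    tendsto_strongFractionalPaintNumber_sub_strongFractionalChoiceNumber⟩
  exact tendsto_const_nhds.div_atTop (Real.tendsto_sqrt_atTop.comp tendsto_logb_two_logb_two)
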